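/- **Setting.** Let $\mathcal H$ be a separable complex Hilbert space, $H$ a self-adjoint (possibly unbounded) operator in $\mathcal H$, and $V$ a symmetric operator which is relatively $H$-bounded, i.e. $\operatorname{dom}H\subseteq\operatorname{dom}V$ and there are $a,b\ge 0$ with $\|V\psi\|\le a\|H\psi\|+b\|\psi\|$ for all $\psi\in\operatorname{dom}H$. Assume that the $H$-bound $a_0$ of $V$ (the infimum of all such $a$) satisfies $a_0<1$. Put $u(x)=x-i$. Let $W_0(\mathbb R)$ be the set of $g\in C_0(\mathbb R)$ of the form $g(x)=\int_{\mathbb R}e^{ixy}\,d\mu(y)$ with a finite complex Borel measure $\mu$, and write $\|\hat g\|_1$ for the total variation $|\mu|(\mathbb R)$ of this measure. For $n\ge0$ let $\mathscr W_n(\mathbb R)=\{f\in C^n(\mathbb R): (fu^p)^{(p)}\in W_0(\mathbb R),\ p=0,\dots,n\}$. Let $f\in\bigcap_{n\ge1}\mathscr W_n(\mathbb R)$, and let $c_f,C_f\ge0$ be constants. **Theorem.** For $t\in\mathbb R$ with $|t|a_0<1$ the operator $H+tV$ is self-adjoint, and $t\mapsto f(H+tV)$ is infinitely differentiable at $t=0$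 in operator norm. Moreover: 1. If $\|\widehat{(fu^n)^{(n)}}\|_1\le c_fC_f^n\,n!$ for all $n\ge1$ and $(1+C_f)\|V(H-i)^{-1}\|<1$, then $$f(H+V)=\sum_{n=0}^\infty\frac1{n!}\frac{d^n}{dt^n}f(H+tV)\Big|_{t=0},$$ and the series converges absolutely in operator norm. 2. If $\|\widehat{(fu^n)^{(n)}}\|_1\le c_fC_f^n\,n!$ for all $n\ge0$, then for all $n\ge0$ $$\Big\|f(H+V)-\sum_{k=0}^{n-1}\frac1{k!}\frac{d^k}{dt^k}f(H+tV)\Big|_{t=0}\Big\|\le c_f\big((1+C_f)\|V(H-i)^{-1}\|\big)^n.$$ 3. If $\|\widehat{(fu^n)^{(n)}}\|_1\le c_fC_f^n\,(n!)^\gamma$ for all $n\ge1$ and some real $\gamma<1$, and if $\|V(H-i)^{-1}\|<1$, then the conclusion of part 1 holds, whatever the size of $C_f$. -/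

import Mathlib

open Filter Topology MeasureTheory
open scoped ENNReal ContDiff

noncomputable section

namespace RelTaylor

/-! ### Function spaces -/

/-- The function `u(x) = x - i`. -/
def u (x : ℝ) : ℂ := (x : ℂ) - Complex.I

/-- `g(x) = ∫ e^{ixy} dμ(y)` for all real `x`, for a (finite) complex measure `μ`. -/
def IsFourierOf (g : ℝ → ℂ) (μ : ComplexMeasure ℝ) : Prop :=
  ∀ x : ℝ, g x = μ.integral (fun y : ℝ => Complex.exp (Complex.I * x * y))
    (ContinuousLinearMap.mul ℝ ℂ)

/-- `W₀(ℝ)`: functions in `C₀(ℝ)` that are Fourier transforms of finite complex measures. -/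
def W₀ : Set (ℝ → ℂ) :=
  {g | Continuous g ∧ Tendsto g (cocompact ℝ) (𝓝 0) ∧ ∃ μ : ComplexMeasure ℝ, IsFourierOf g μ}

/-- The function `(f uⁿ)⁽ⁿ⁾`. -/
def weightedDeriv (f : ℝ → ℂ) (n : ℕ) : ℝ → ℂ :=
  iteratedDeriv n (fun x => f x * u x ^ n)

/-- `𝒲ₙ(ℝ)`: the `f ∈ Cⁿ(ℝ)` with `(f uᵖ)⁽ᵖ⁾ ∈ W₀(ℝ)` for `p = 0, …, n`. -/
def W (n : ℕ) : Set (ℝ → ℂ) :=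
  {f | ContDiff ℝ n f ∧ ∀ p ≤ n, weightedDeriv f p ∈ W₀}

/-! ### Unbounded operators -/

variable {E : Type*} [NormedAddCommGroup E] [InnerProductSpace ℂ E] [CompleteSpace E]

/-- `a, b ≥ 0` are constants of relative boundedness: `dom H ⊆ dom V` and
`‖Vψ‖ ≤ a ‖Hψ‖ + b ‖ψ‖` on `dom H`. -/
def RelBoundedWith (H V : E →ₗ.[ℂ] E) (a b : ℝ) : Prop :=
  0 ≤ a ∧ 0 ≤ b ∧ ∀ ψ : H.domain, ∃ hψ : (ψ : E) ∈ V.domain,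
    ‖V ⟨ψ, hψ⟩‖ ≤ a * ‖H ψ‖ + b * ‖(ψ : E)‖

/-- `V` is relatively `H`-bounded. -/
def RelBounded (H V : E →ₗ.[ℂ] E) : Prop :=
  ∃ a b : ℝ, RelBoundedWith H V a b

/-- The `H`-bound of `V`. -/
def relBound (H V : E →ₗ.[ℂ] E) : ℝ :=
  sInf {a | ∃ b, RelBoundedWith H V a b}

/-- `R` is a bounded two-sided inverse of `A - z : dom A → E`. -/
def IsResolvent (A : E →ₗ.[ℂ] E) (z : ℂ) (R : E →L[ℂ] E) : Prop :=
  (∀ x : E, ∃ hx : R x ∈ A.domain, A ⟨R x, hx⟩ - z • R x = x) ∧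
    ∀ x : A.domain, R (A x - z • (x : E)) = x

open Classical in
/-- The bounded operator `(A - z)⁻¹` (it is unique when it exists; `0` otherwise). -/
def resolventOp (A : E →ₗ.[ℂ] E) (z : ℂ) : E →L[ℂ] E :=
  if h : ∃ R, IsResolvent A z R then h.choose else 0

open Classical in
/-- The bounded operator `V (H - i)⁻¹` (unique when it exists, as it does for `H` self-adjoint
and `V` relatively `H`-bounded; `0` otherwise). -/
def relOp (H V : E →ₗ.[ℂ] E) : E →L[ℂ] E :=
  if h : ∃ T : E →L[ℂ] E, ∀ x : E, ∃ hx : resolventOp H Complex.I x ∈ V.domain,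
      T x = V ⟨resolventOp H Complex.I x, hx⟩ then h.choose else 0

/-- The functional calculus `f(A)` of a self-adjoint operator `A` for `f ∈ C₀(ℝ)`, obtained from the
continuous functional calculus of the bounded normal operator `R = (A - i)⁻¹`: the spectrum of `R`
consists of the points `w = (λ - i)⁻¹`, `λ ∈ σ(A)`, and of `0` if `A` is unbounded; there
`λ = Re w⁻¹`, and the function `λ ↦ f(λ)` of `w` extends continuously by `0` to `w = 0`. -/
def funcCalc (f : ℝ → ℂ) (A : E →ₗ.[ℂ] E) : E →L[ℂ] E :=
  cfc (fun w : ℂ => if w = 0 then 0 else f (w⁻¹).re) (resolventOp A Complex.I)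

/-- The operator `H + tV`, with domain `dom H ∩ dom V`. -/
def pert (H V : E →ₗ.[ℂ] E) (t : ℝ) : E →ₗ.[ℂ] E := H + (t : ℂ) • V

/-- The `n`-th Taylor term `(1/n!) dⁿ/dtⁿ f(H + tV)|_{t=0}`, the derivatives being
taken in operator norm. -/
def taylorTerm (f : ℝ → ℂ) (H V : E →ₗ.[ℂ] E) (n : ℕ) : E →L[ℂ] E :=
  ((n.factorial : ℝ)⁻¹) • iteratedDeriv n (fun t : ℝ => funcCalc f (pert H V t)) 0

end RelTaylor

end

/-!
Let `R = (H - i)⁻¹`, `S = (H + tV - i)⁻¹` and `K = V (H - i)⁻¹`, so that `R - S = t • S * K`. A fine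
partition of unity on the spectrum of `R` gives operators `P x` with `∑ P x = 1` for which
`R * P x ≈ (x - i)⁻¹ • P x` and `f(H) ≈ ∑ f(x) • P x`, and similarly operators `Q x` for `S`. The
divided differences of the functions `f uᵖ`, weighted by values of `u`, satisfy a recursion that is
homogeneous in the resolvent values `(x - i)⁻¹`. Together with the identity for `R - S` it lets a
Taylor formula for `f(H + tV)` telescope: the Taylor terms and the remainder are sums over products
of the operators `P x`, `Q x` and `K`, with these divided differences as coefficients.

Since `(f uᵖ)⁽ᵖ⁾` is the Fourier transform of `μ p`, its divided differences are superpositions of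
exponentials, so these sums do not exceed `‖K‖ⁿ ∑ (n choose p) |μ p|(ℝ) / p!` in norm, whatever the
partition. Hence they have weak limits along an ultrafilter as the partitions get finer, and these
limits obey the same bounds. Because the resulting expansion holds for all small perturbations of
every `H + tV` with `t` near `0`, with uniform bounds, the converse of Taylor's theorem makes
`t ↦ f(H + tV)` smooth at `0` and identifies the coefficients with its derivatives. If
`|μ p|(ℝ) ≤ c Cᵖ p!`, the binomial theorem turns the bound into `c ((1 + C) ‖K‖)ⁿ`.
-/

noncomputable section

namespace RelTaylor

/-! ### Complex measures and Fourier transforms -/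

instance isFiniteMeasure_variation {α : Type*} [MeasurableSpace α] (μ : ComplexMeasure α) :
    IsFiniteMeasure μ.variation := by
  refine isFiniteMeasure_of_le (μ.re.totalVariation + μ.im.totalVariation) ?_
  refine VectorMeasure.variation_le_of_forall_enorm_le fun s _ => ?_
  calc ‖μ s‖ₑ = ‖((μ s).re : ℂ) + (μ s).im * Complex.I‖ₑ := by rw [Complex.re_add_im]
    _ ≤ ‖(μ s).re‖ₑ + ‖(μ s).im‖ₑ := by
      refine (enorm_add_le _ _).trans_eq ?_
      simp [enorm_eq_nnnorm]
    _ ≤ μ.re.totalVariation s + μ.im.totalVariation s :=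
      add_le_add (SignedMeasure.enorm_le_totalVariation μ.re s)
        (SignedMeasure.enorm_le_totalVariation μ.im s)

lemma integral_const_mul {α : Type*} [MeasurableSpace α] (μ : ComplexMeasure α) (c : ℂ)
    (φ : α → ℂ) :
    μ.integral (fun y => c * φ y) (ContinuousLinearMap.mul ℝ ℂ)
      = c * μ.integral φ (ContinuousLinearMap.mul ℝ ℂ) := by
  rw [VectorMeasure.integral_eq_setToFun, VectorMeasure.integral_eq_setToFun]
  refine setToFun_smul (𝕜 := ℂ) _ (fun c s x => ?_) c φ
  change cbmApplyMeasure μ (ContinuousLinearMap.mul ℝ ℂ) s (c • x)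
    = c • cbmApplyMeasure μ (ContinuousLinearMap.mul ℝ ℂ) s x
  simp [mul_assoc]

lemma integrable_const_mul_exp (μ : ComplexMeasure ℝ) (c : ℂ) (x : ℝ) :
    μ.Integrable (fun y : ℝ => c * Complex.exp (Complex.I * x * y)) := by
  refine Integrable.const_mul ?_ c
  refine (integrable_const (1 : ℝ)).mono' (by fun_prop) (Eventually.of_forall fun y => ?_)
  rw [show Complex.I * x * y = ((x * y : ℝ) : ℂ) * Complex.I by push_cast; ring,
    Complex.norm_exp_ofReal_mul_I]

/-- If `g` is the Fourier transform of `ν`, then `∑ g(x_k) L_k` is the integral against `ν` of the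
trigonometric polynomials `∑ e^{i y x_k} L_k`; this is tested on functionals, since the integral
against `ν` is only available for scalar functions. -/
lemma norm_sum_smul_le_of_isFourierOf {Y ι : Type*} [NormedAddCommGroup Y] [NormedSpace ℂ Y]
    {g : ℝ → ℂ} {ν : ComplexMeasure ℝ} (hν : IsFourierOf g ν) (s : Finset ι)
    (L : ι → Y) (x : ι → ℝ) {M : ℝ}
    (hM : ∀ y : ℝ, ‖∑ k ∈ s, Complex.exp (Complex.I * x k * y) • L k‖ ≤ M) :
    ‖∑ k ∈ s, g (x k) • L k‖ ≤ M * ν.variation.real Set.univ := by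
  have hM0 : 0 ≤ M := (norm_nonneg _).trans (hM 0)
  obtain ⟨φ, hφ, hφ_eq⟩ := exists_dual_vector'' ℂ (∑ k ∈ s, g (x k) • L k)
  have map_eq : ∀ c : ι → ℂ, φ (∑ k ∈ s, c k • L k) = ∑ k ∈ s, φ (L k) * c k := fun c => by
    simp only [map_sum, map_smul, smul_eq_mul, mul_comm]
  have integral_eq : φ (∑ k ∈ s, g (x k) • L k)
      = ν.integral (fun y : ℝ => φ (∑ k ∈ s, Complex.exp (Complex.I * x k * y) • L k))
        (ContinuousLinearMap.mul ℝ ℂ) := by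
    simp only [map_eq]
    rw [VectorMeasure.integral_finsetSum _ fun k _ => integrable_const_mul_exp ν _ _]
    simp only [integral_const_mul, hν (x _)]
  have h := VectorMeasure.norm_integral_le_of_norm_le_const (μ := ν)
    (B := ContinuousLinearMap.mul ℝ ℂ) (C := M) (Eventually.of_forall fun y =>
      (φ.le_of_opNorm_le hφ (∑ k ∈ s, Complex.exp (Complex.I * x k * y) • L k)).trans
        (by rw [one_mul]; exact hM y))
  rw [← integral_eq, hφ_eq, RCLike.norm_ofReal, abs_norm] at h
  refine h.trans ?_
  gcongr
  exact mul_le_of_le_one_right hM0 (ContinuousLinearMap.opNorm_mul_le ℝ ℂ)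

/-! ### Divided differences -/

section Derivatives

variable {Y : Type*} [NormedAddCommGroup Y] [NormedSpace ℝ Y]

lemma iteratedDeriv_eqOn_of_hasDerivAt_succ {b : ℕ → ℝ → Y} {s : Set ℝ} (hs : IsOpen s)
    (hb : ∀ k, ∀ x ∈ s, HasDerivAt (b k) (b (k + 1) x) x) (k : ℕ) :
    Set.EqOn (iteratedDeriv k (b 0)) (b k) s := by
  induction k with
  | zero => simp [Set.EqOn]
  | succ k ih =>
    intro x hx
    rw [iteratedDeriv_succ, (ih.eventuallyEq_of_mem (hs.mem_nhds hx)).deriv_eq, (hb k x hx).deriv]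

lemma contDiffOn_of_hasDerivAt_succ {b : ℕ → ℝ → Y} {s : Set ℝ} (hs : IsOpen s)
    (hb : ∀ k, ∀ x ∈ s, HasDerivAt (b k) (b (k + 1) x) x) : ContDiffOn ℝ ∞ (b 0) s :=
  contDiffOn_of_differentiableOn_deriv fun k _ => DifferentiableOn.congr
    (fun x hx => (hb k x hx).differentiableAt.differentiableWithinAt)
    fun _ hx => (iteratedDerivWithin_of_isOpen hs hx).trans
      (iteratedDeriv_eqOn_of_hasDerivAt_succ hs hb k hx)

lemma continuous_iteratedDeriv {h : ℝ → Y} (hh : ContDiff ℝ ∞ h) (k : ℕ) :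
    Continuous (iteratedDeriv k h) :=
  hh.continuous_iteratedDeriv k (by exact_mod_cast le_top)

lemma hasDerivAt_iteratedDeriv {h : ℝ → Y} (hh : ContDiff ℝ ∞ h) (k : ℕ) (x : ℝ) :
    HasDerivAt (iteratedDeriv k h) (iteratedDeriv (k + 1) h x) x := by
  rw [iteratedDeriv_succ]
  exact (hh.differentiable_iteratedDeriv k (by exact_mod_cast WithTop.coe_lt_top k)
    x).hasDerivAt

lemma hasDerivAt_integral_of_continuous {F F' : ℝ → ℝ → Y} (hF : ∀ x, Continuous (F x))
    (hF' : Continuous (Function.uncurry F'))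
    (hd : ∀ x θ, HasDerivAt (fun x => F x θ) (F' x θ) x) (a b x : ℝ) :
    HasDerivAt (fun x => ∫ θ in a..b, F x θ) (∫ θ in a..b, F' x θ) x := by
  obtain ⟨C, hC⟩ := ((isCompact_closedBall x 1).prod
    (isCompact_uIcc (a := a) (b := b))).exists_bound_of_continuousOn hF'.continuousOn
  refine (intervalIntegral.hasDerivAt_integral_of_dominated_loc_of_deriv_le (bound := fun _ => C)
    (Metric.closedBall_mem_nhds x one_pos)
    (Eventually.of_forall fun x => (hF x).aestronglyMeasurable)
    ((hF x).intervalIntegrable a b) (hF'.uncurry_left x).aestronglyMeasurable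
    (Eventually.of_forall fun θ hθ y hy => ?_) intervalIntegrable_const
    (Eventually.of_forall fun θ _ y _ => hd y θ)).2
  exact hC (y, θ) ⟨hy, Set.uIoc_subset_uIcc hθ⟩

lemma norm_integral_pow_smul_le {F : ℝ → Y} {D : ℝ} (hF : ∀ θ, ‖F θ‖ ≤ D) (j : ℕ) :
    ‖∫ θ in (0 : ℝ)..1, θ ^ j • F θ‖ ≤ D / (j + 1) :=
  calc ‖∫ θ in (0 : ℝ)..1, θ ^ j • F θ‖ ≤ ∫ θ in (0 : ℝ)..1, θ ^ j * D := by
        refine intervalIntegral.norm_integral_le_of_norm_le zero_le_one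
          (Eventually.of_forall fun θ hθ => ?_) (Continuous.intervalIntegrable (by fun_prop) _ _)
        rw [norm_smul, norm_pow, Real.norm_of_nonneg hθ.1.le]
        exact mul_le_mul_of_nonneg_left (hF θ) (pow_nonneg hθ.1.le j)
    _ = D / (j + 1) := by
        rw [intervalIntegral.integral_mul_const, integral_pow, one_pow,
          zero_pow j.succ_ne_zero, sub_zero, one_div_mul_eq_div]

variable {h : ℝ → Y}

lemma hasDerivAt_integral_pow_smul_iteratedDeriv (hh : ContDiff ℝ ∞ h) (z : ℝ) (k : ℕ) (x : ℝ) :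
    HasDerivAt (fun x => ∫ θ in (0 : ℝ)..1, θ ^ k • iteratedDeriv (k + 1) h (z + θ * (x - z)))
      (∫ θ in (0 : ℝ)..1, θ ^ (k + 1) • iteratedDeriv (k + 2) h (z + θ * (x - z))) x := by
  have hc := continuous_iteratedDeriv hh
  refine hasDerivAt_integral_of_continuous
    (F' := fun x θ => θ ^ (k + 1) • iteratedDeriv (k + 2) h (z + θ * (x - z)))
    (fun x => (continuous_pow k).smul ((hc (k + 1)).comp
      (f := fun θ : ℝ => z + θ * (x - z)) (by fun_prop)))
    ((continuous_snd.pow (k + 1)).smul ((hc (k + 2)).comp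
      (f := fun q : ℝ × ℝ => z + q.2 * (q.1 - z)) (by fun_prop))) (fun x θ => ?_) 0 1 x
  have hlin : HasDerivAt (fun x : ℝ => z + θ * (x - z)) θ x := by
    simpa using (((hasDerivAt_id x).sub_const z).const_mul θ).const_add z
  rw [pow_succ, mul_smul]
  exact ((hasDerivAt_iteratedDeriv hh (k + 1) (z + θ * (x - z))).scomp x hlin).const_smul (θ ^ k)

variable [CompleteSpace Y]

lemma dslope_eq_integral (hh : ContDiff ℝ 1 h) (z x : ℝ) :
    dslope h z x = ∫ θ in (0 : ℝ)..1, deriv h (z + θ * (x - z)) := by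
  rcases eq_or_ne x z with rfl | hne
  · simp [dslope_same]
  · rw [← smul_right_inj (sub_ne_zero.2 hne), sub_smul_dslope]
    have := intervalIntegral.integral_unitInterval_deriv_eq_sub (f := h) (f' := deriv h)
      (z₀ := z) (z₁ := x - z) (((hh.continuous_deriv le_rfl).comp (by fun_prop)).continuousOn)
      (fun t _ => (hh.differentiable one_ne_zero _).hasDerivAt)
    simpa using this.symm

lemma dslope_eq_integral_pow_zero (hh : ContDiff ℝ ∞ h) (z : ℝ) : dslope h z =
    fun x => ∫ θ in (0 : ℝ)..1, θ ^ 0 • iteratedDeriv (0 + 1) h (z + θ * (x - z)) := by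
  ext x
  simp only [dslope_eq_integral (hh.of_le (by simp)), pow_zero, one_smul, zero_add,
    iteratedDeriv_one]

lemma contDiff_dslope (hh : ContDiff ℝ ∞ h) (z : ℝ) : ContDiff ℝ ∞ (dslope h z) := by
  rw [dslope_eq_integral_pow_zero hh]
  exact contDiffOn_univ.1 (contDiffOn_of_hasDerivAt_succ isOpen_univ
    fun k x _ => hasDerivAt_integral_pow_smul_iteratedDeriv hh z k x)

lemma iteratedDeriv_dslope (hh : ContDiff ℝ ∞ h) (z : ℝ) (k : ℕ) (x : ℝ) :
    iteratedDeriv k (dslope h z) x =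
      ∫ θ in (0 : ℝ)..1, θ ^ k • iteratedDeriv (k + 1) h (z + θ * (x - z)) := by
  rw [dslope_eq_integral_pow_zero hh]
  exact iteratedDeriv_eqOn_of_hasDerivAt_succ isOpen_univ
    (fun k x _ => hasDerivAt_integral_pow_smul_iteratedDeriv hh z k x) k (Set.mem_univ x)

end Derivatives

lemma contDiff_u : ContDiff ℝ ∞ u :=
  Complex.ofRealCLM.contDiff.sub contDiff_const

lemma hasDerivAt_u (x : ℝ) : HasDerivAt u 1 x :=
  Complex.ofRealCLM.hasDerivAt.sub_const Complex.I

lemma u_ne_zero (x : ℝ) : u x ≠ 0 := fun h => by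
  simpa [u] using congrArg Complex.im h

lemma dslope_u_mul {h : ℝ → ℂ} (hh : Differentiable ℝ h) (z x : ℝ) :
    dslope (fun x => u x * h x) z x = u x * dslope h z x + h z := by
  rcases eq_or_ne x z with rfl | hne
  · rw [dslope_same, dslope_same, deriv_fun_mul (hasDerivAt_u x).differentiableAt (hh x),
      (hasDerivAt_u x).deriv, one_mul, add_comm]
  · have h_sub := sub_smul_dslope h z x
    rw [← smul_right_inj (sub_ne_zero.2 hne), sub_smul_dslope]
    simp only [Complex.real_smul, Complex.ofReal_sub, u] at h_sub ⊢
    linear_combination (Complex.I - x) * h_sub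

lemma dslope_add_const (h : ℝ → ℂ) (c : ℂ) (z : ℝ) : dslope (fun x => h x + c) z = dslope h z := by
  ext x
  rcases eq_or_ne x z with rfl | hne
  · simp only [dslope_same, deriv_add_const]
  · simp only [dslope_of_ne _ hne, slope_def_module, add_sub_add_right_eq_sub]

/-- The iterated divided difference `g^{[p]}(x, z₁, …, z_p)`, for the list `[z₁, …, z_p]` of
possibly repeated nodes. -/
def dividedDiff (g : ℝ → ℂ) : List ℝ → ℝ → ℂ
  | [] => g
  | z :: l => dslope (dividedDiff g l) z

lemma contDiff_dividedDiff {g : ℝ → ℂ} (hg : ContDiff ℝ ∞ g) : ∀ l, ContDiff ℝ ∞ (dividedDiff g l)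
  | [] => hg
  | z :: l => contDiff_dslope (contDiff_dividedDiff hg l) z

lemma dividedDiff_u_mul_cons {g : ℝ → ℂ} (hg : ContDiff ℝ ∞ g) (l : List ℝ) (z x : ℝ) :
    dividedDiff (fun x => u x * g x) (z :: l) x
      = u x * dividedDiff g (z :: l) x + dividedDiff g l z := by
  have hd : ∀ l, Differentiable ℝ (dividedDiff g l) := fun l =>
    (contDiff_dividedDiff hg l).differentiable (by simp)
  induction l generalizing z x with
  | nil => exact dslope_u_mul (hd []) z x
  | cons z' l ih =>
    rw [dividedDiff, funext (ih z'), dslope_add_const, dslope_u_mul (hd _)]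
    rfl

/-- The divided difference `(f uᵖ)^{[p]}(x, z₁, …, z_p)`: it is the coefficient in the `p`-th term
of the noncommutative Taylor formula. -/
def weightedDiff (f : ℝ → ℂ) (x : ℝ) (l : List ℝ) : ℂ :=
  dividedDiff (fun x => f x * u x ^ l.length) l x

lemma weightedDiff_nil (f : ℝ → ℂ) (x : ℝ) : weightedDiff f x [] = f x := by
  simp [weightedDiff, dividedDiff]

/-- The weights `uᵖ` make the recursion for divided differences homogeneous in the values
`(u x)⁻¹`, `(u z)⁻¹` of the resolvent. -/
lemma sub_inv_u_mul_weightedDiff_cons {f : ℝ → ℂ} (hf : ContDiff ℝ ∞ f) (x z : ℝ) (l : List ℝ) :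
    ((u z)⁻¹ - (u x)⁻¹) * weightedDiff f x (z :: l)
      = (u z)⁻¹ * weightedDiff f x l - (u x)⁻¹ * weightedDiff f z l := by
  set g := fun x => f x * u x ^ l.length with hg_def
  have hg : ContDiff ℝ ∞ g := hf.mul (contDiff_u.pow _)
  have cons_eq : weightedDiff f x (z :: l)
      = u x * dividedDiff g (z :: l) x + dividedDiff g l z := by
    rw [← dividedDiff_u_mul_cons hg, weightedDiff]
    congr 1
    ext x
    rw [hg_def, List.length_cons, pow_succ]
    ring
  have sub_mul : (u x - u z) * dividedDiff g (z :: l) x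
      = dividedDiff g l x - dividedDiff g l z := by
    rw [← sub_smul_dslope (dividedDiff g l) z x, Complex.real_smul]
    simp [u, dividedDiff]
  rw [cons_eq, weightedDiff, weightedDiff]
  field_simp [u_ne_zero]
  linear_combination (u x) * sub_mul

/-- The phase `∑ y_k a_k` of the exponential with frequencies `y` at the nodes `[a₀, a₁, …]`. -/
def phase : (ℕ → ℝ) → List ℝ → ℝ
  | _, [] => 0
  | y, a :: l => y 0 * a + phase (fun k => y (k + 1)) l

lemma phase_append_singleton (y : ℕ → ℝ) (l : List ℝ) (a : ℝ) :
    phase y (l ++ [a]) = phase y l + y l.length * a := by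
  induction l generalizing y with
  | nil => simp [phase]
  | cons b l ih => simp [phase, ih]; ring

section Multipliers

variable {Y ι : Type*} [NormedAddCommGroup Y] [NormedSpace ℂ Y]

/-- `M` bounds all the exponential sums `∑ e^{i ⟨y, m_k⟩} L_k` attached to the vectors `L_k` and the
lists of nodes `m_k`. -/
def ExpSumBound (s : Finset ι) (m : ι → List ℝ) (L : ι → Y) (M : ℝ) : Prop :=
  ∀ y : ℕ → ℝ, ‖∑ k ∈ s, Complex.exp (Complex.I * phase y (m k)) • L k‖ ≤ M

lemma ExpSumBound.cons_segment {s : Finset ι} {a x : ι → ℝ} {m : ι → List ℝ} {L : ι → Y} {M : ℝ}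
    (hM : ExpSumBound s (fun k => x k :: a k :: m k) L M) (θ : ℝ) :
    ExpSumBound s (fun k => (a k + θ * (x k - a k)) :: m k) L M := fun y => by
  convert hM fun n => match n with
    | 0 => y 0 * θ
    | 1 => y 0 * (1 - θ)
    | n + 2 => y (n + 1) using 7 with k
  simp only [phase]
  ring

variable [CompleteSpace Y]

lemma norm_sum_iteratedDeriv_dslope_smul_le {h : ι → ℝ → ℂ} {s : Finset ι}
    (hh : ∀ k, ContDiff ℝ ∞ (h k)) (a x : ι → ℝ) (L : ι → Y) (j : ℕ) {D : ℝ}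
    (hD : ∀ θ : ℝ,
      ‖∑ k ∈ s, iteratedDeriv (j + 1) (h k) (a k + θ * (x k - a k)) • L k‖ ≤ D) :
    ‖∑ k ∈ s, iteratedDeriv j (dslope (h k) (a k)) (x k) • L k‖ ≤ D / (j + 1) := by
  have hcont : ∀ k, Continuous fun θ : ℝ =>
      (θ ^ j • iteratedDeriv (j + 1) (h k) (a k + θ * (x k - a k))) • L k := fun k =>
    ((continuous_pow j).smul
      ((continuous_iteratedDeriv (hh k) (j + 1)).comp (by fun_prop))).smul continuous_const
  have sum_eq : ∑ k ∈ s, iteratedDeriv j (dslope (h k) (a k)) (x k) • L k = ∫ θ in (0 : ℝ)..1,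
      θ ^ j • ∑ k ∈ s, iteratedDeriv (j + 1) (h k) (a k + θ * (x k - a k)) • L k := by
    simp only [Finset.smul_sum, ← smul_assoc]
    rw [intervalIntegral.integral_finsetSum fun k _ => (hcont k).intervalIntegrable _ _]
    simp only [intervalIntegral.integral_smul_const, iteratedDeriv_dslope (hh _)]
  rw [sum_eq]
  exact norm_integral_pow_smul_le hD j

lemma norm_sum_iteratedDeriv_dividedDiff_smul_le {g : ℝ → ℂ} (hg : ContDiff ℝ ∞ g) (p j : ℕ)
    {ν : ComplexMeasure ℝ} (hν : IsFourierOf (iteratedDeriv (p + j) g) ν) {s : Finset ι}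
    {L : ι → Y} {x : ι → ℝ} {z : ι → List ℝ} (hz : ∀ k, (z k).length = p) {M : ℝ}
    (hM : ExpSumBound s (fun k => x k :: z k) L M) :
    ‖∑ k ∈ s, iteratedDeriv j (dividedDiff g (z k)) (x k) • L k‖
      ≤ M * ν.variation.real Set.univ * (j.factorial / (p + j).factorial) := by
  induction p generalizing j x z with
  | zero =>
    obtain rfl : z = fun _ => [] := funext fun k => List.length_eq_zero_iff.1 (hz k)
    rw [zero_add] at hν ⊢
    rw [div_self (by positivity), mul_one]
    refine norm_sum_smul_le_of_isFourierOf hν s L x fun y => ?_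
    convert hM fun _ => y using 5 with k
    simp only [phase, add_zero, Complex.ofReal_mul]
    ring
  | succ p ih =>
    choose a w haw using fun k => List.exists_cons_of_length_eq_add_one (hz k)
    obtain rfl : z = fun k => a k :: w k := funext haw
    have hstep := norm_sum_iteratedDeriv_dslope_smul_le
      (fun k => contDiff_dividedDiff hg (w k)) a x L j fun θ =>
        ih (j + 1) (by rwa [show p + (j + 1) = p + 1 + j by ring])
          (fun k => Nat.succ_injective (hz k)) (hM.cons_segment θ)
    refine hstep.trans_eq ?_
    rw [show p + (j + 1) = p + 1 + j by ring, Nat.factorial_succ j]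
    push_cast
    field_simp

lemma norm_sum_weightedDiff_smul_le {f : ℝ → ℂ} (hf : ContDiff ℝ ∞ f) {p : ℕ}
    {ν : ComplexMeasure ℝ} (hν : IsFourierOf (weightedDeriv f p) ν) {s : Finset ι}
    {L : ι → Y} {x : ι → ℝ} {z : ι → List ℝ} (hz : ∀ k, (z k).length = p) {M : ℝ}
    (hM : ExpSumBound s (fun k => x k :: z k) L M) :
    ‖∑ k ∈ s, weightedDiff f (x k) (z k) • L k‖
      ≤ M * (ν.variation.real Set.univ / p.factorial) := by
  have h := norm_sum_iteratedDeriv_dividedDiff_smul_le (hf.mul (contDiff_u.pow p)) p 0 hν hz hM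
  simpa [weightedDiff, hz, div_eq_mul_inv, mul_assoc] using h

end Multipliers

/-! ### Approximate spectral resolutions -/

/-- The circle formed by `0` and the values `(x - i)⁻¹` of the resolvent, for `x` real. -/
def resolventCircle : Set ℂ := Metric.sphere (Complex.I / 2) (1 / 2)

lemma mem_resolventCircle_iff (w : ℂ) : w ∈ resolventCircle ↔ Complex.normSq w = w.im := by
  rw [resolventCircle, mem_sphere_iff_norm, ← sq_eq_sq₀ (norm_nonneg _) (by norm_num),
    ← Complex.normSq_eq_norm_sq, Complex.normSq_apply, Complex.normSq_apply]
  simp only [Complex.sub_re, Complex.sub_im, Complex.div_ofNat_re, Complex.div_ofNat_im,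
    Complex.I_re, Complex.I_im]
  constructor <;> intro h <;> linarith

lemma inv_eq_u {w : ℂ} (hw : w ∈ resolventCircle) (h0 : w ≠ 0) : w⁻¹ = u (w⁻¹).re := by
  rw [mem_resolventCircle_iff] at hw
  have h := mt Complex.normSq_eq_zero.1 h0
  apply Complex.ext
  · simp [u]
  · rw [Complex.inv_im, hw]
    rw [hw] at h
    simp [u, h]

lemma tendsto_re_inv_cocompact :
    Tendsto (fun w : ℂ => (w⁻¹).re) (𝓝[resolventCircle \ {0}] 0) (cocompact ℝ) := by
  rw [← Metric.cobounded_eq_cocompact, ← tendsto_norm_atTop_iff_cobounded]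
  have tendsto_norm_inv : Tendsto (fun w : ℂ => ‖w⁻¹‖ - 1) (𝓝[resolventCircle \ {0}] 0) atTop :=
    tendsto_atTop_add_const_right _ _ <| (tendsto_norm_inv_nhdsNE_zero_atTop (α := ℂ)).mono_left <|
      nhdsWithin_mono _ fun x hx => hx.2
  refine tendsto_atTop_mono' _ ?_ tendsto_norm_inv
  filter_upwards [self_mem_nhdsWithin] with w hw
  have h := norm_sub_le (((w⁻¹).re : ℝ) : ℂ) Complex.I
  rw [← u, ← inv_eq_u hw.1 hw.2, Complex.norm_I, Complex.norm_real] at h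
  linarith

lemma tendsto_inv_u : Tendsto (fun x => (u x)⁻¹) (cocompact ℝ) (𝓝 0) := by
  refine tendsto_inv₀_cobounded.comp (tendsto_norm_atTop_iff_cobounded.1 ?_)
  refine tendsto_atTop_mono (fun x => ?_) (tendsto_norm_cocompact_atTop (E := ℝ))
  simpa [u] using Complex.abs_re_le_norm (u x)

/-- The function on the complex plane that corresponds to `f` in the variable `w = (x - i)⁻¹`, as
in the definition of `funcCalc`. -/
def resolventLift (f : ℝ → ℂ) (w : ℂ) : ℂ := if w = 0 then 0 else f (w⁻¹).re

lemma continuousOn_resolventLift {f : ℝ → ℂ} (hf : Continuous f)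
    (hf0 : Tendsto f (cocompact ℝ) (𝓝 0)) : ContinuousOn (resolventLift f) resolventCircle := by
  intro w _
  rcases eq_or_ne w 0 with rfl | hw
  · rw [← continuousWithinAt_sdiff_self, ContinuousWithinAt, resolventLift, if_pos rfl]
    refine (hf0.comp tendsto_re_inv_cocompact).congr' ?_
    filter_upwards [self_mem_nhdsWithin] with v hv
    exact (if_neg hv.2).symm
  · have hcont : ContinuousAt (fun w : ℂ => f (w⁻¹).re) w :=
      hf.continuousAt.comp (Complex.continuous_re.continuousAt.comp (continuousAt_inv₀ hw))
    refine (hcont.congr ?_).continuousWithinAt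
    filter_upwards [isOpen_ne.mem_nhds hw] with v hv
    exact (if_neg hv).symm

lemma exists_norm_sub_inv_u_lt {f : ℝ → ℂ} (hf0 : Tendsto f (cocompact ℝ) (𝓝 0)) {w : ℂ}
    (hw : w ∈ resolventCircle) {δ : ℝ} (hδ : 0 < δ) :
    ∃ x : ℝ, ‖w - (u x)⁻¹‖ < δ ∧ ‖resolventLift f w - f x‖ < δ := by
  rcases eq_or_ne w 0 with rfl | h0
  · obtain ⟨x, hx⟩ := ((tendsto_inv_u.norm.eventually_lt_const (by simpa using hδ)).and
      (hf0.norm.eventually_lt_const (by simpa using hδ))).exists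
    exact ⟨x, by simpa [resolventLift] using hx⟩
  · exact ⟨(w⁻¹).re, by rw [← inv_eq_u hw h0]; simpa [resolventLift, h0] using hδ⟩

lemma exists_finset_partitionOfUnity {X ι : Type*} [TopologicalSpace X] [CompactSpace X]
    [T2Space X] {U : ι → Set X} (hU : ∀ i, IsOpen (U i)) (hcover : ⋃ i, U i = Set.univ) :
    ∃ (t : Finset ι) (ρ : ι → C(X, ℝ)), (∀ i x, 0 ≤ ρ i x) ∧ (∀ x, ∑ i ∈ t, ρ i x = 1) ∧
      ∀ i x, ρ i x ≠ 0 → x ∈ U i := by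
  obtain ⟨ρ, hρ⟩ := PartitionOfUnity.exists_isSubordinate isClosed_univ U hU hcover.ge
  have hfin := ρ.locallyFinite.finite_nonempty_of_compact
  refine ⟨hfin.toFinset, ρ, ρ.nonneg, fun x => ?_, fun i x hx =>
    hρ i (subset_tsupport _ hx)⟩
  rw [← ρ.sum_eq_one (Set.mem_univ x)]
  refine (finsum_eq_sum_of_support_subset _ fun i hi => ?_).symm
  exact hfin.mem_toFinset.2 ⟨x, hi⟩

lemma exists_partition_norm_sum_mul_le {X ι : Type*} [TopologicalSpace X] [CompactSpace X]
    [T2Space X] {U : ι → Set X} (hU : ∀ i, IsOpen (U i)) (hcover : ⋃ i, U i = Set.univ) :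
    ∃ (t : Finset ι) (p : ι → C(X, ℂ)), ∑ i ∈ t, p i = 1 ∧
      ∀ (c : ι → C(X, ℂ)) {ε : ℝ}, 0 ≤ ε → (∀ i, ∀ x ∈ U i, ‖c i x‖ ≤ ε) →
        ‖∑ i ∈ t, c i * p i‖ ≤ ε := by
  obtain ⟨t, ρ, hρ0, hρ_sum, hρ⟩ := exists_finset_partitionOfUnity hU hcover
  refine ⟨t, fun i => ⟨fun x => ρ i x, by fun_prop⟩, ?_, fun c ε hε hc => ?_⟩
  · ext x
    simpa using mod_cast hρ_sum x
  · refine (ContinuousMap.norm_le _ hε).2 fun x => ?_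
    rw [ContinuousMap.sum_apply]
    calc _ ≤ ∑ i ∈ t, ε * ρ i x := norm_sum_le_of_le t fun i _ => by
          change ‖c i x * ρ i x‖ ≤ ε * ρ i x
          rw [norm_mul, Complex.norm_of_nonneg (hρ0 i x)]
          rcases eq_or_ne (ρ i x) 0 with h | h
          · rw [h, mul_zero, mul_zero]
          · exact mul_le_mul_of_nonneg_right (hc i x (hρ i x h)) (hρ0 i x)
      _ = ε := by rw [← Finset.mul_sum, hρ_sum, mul_one]

/-- The elements `P x`, `x ∈ t`, of a Banach algebra imitate the spectral projections of an operator
with resolvent `R` at `i` and spectrum in the finite set `t`, up to an error `δ`. -/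
structure IsApproxResolution {𝒜 : Type*} [NormedRing 𝒜] [NormedAlgebra ℂ 𝒜]
    (R : 𝒜) (δ : ℝ) (t : Finset ℝ) (P : ℝ → 𝒜) : Prop where
  sum_eq_one : ∑ x ∈ t, P x = 1
  commute : ∀ x, Commute R (P x)
  norm_sum_exp_le : ∀ y : ℝ, ‖∑ x ∈ t, Complex.exp (Complex.I * (y * x : ℝ)) • P x‖ ≤ 1
  norm_sum_exp_sub_le : ∀ y : ℝ, ‖∑ x ∈ t, Complex.exp (Complex.I * (y * x : ℝ)) •
    ((R - algebraMap ℂ 𝒜 (u x)⁻¹) * P x)‖ ≤ δ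

section CStarAlgebra

variable {𝒜 : Type*} [CStarAlgebra 𝒜] {R : 𝒜}

/-- The Cayley transform `1 + 2iR` of `R` is unitary, as it is for the resolvent `R` at `i` of a
self-adjoint operator. -/
def IsCayley (R : 𝒜) : Prop := 1 + (2 * Complex.I) • R ∈ unitary 𝒜

lemma IsCayley.isStarNormal (hR : IsCayley R) : IsStarNormal R := by
  have hU : IsStarNormal (1 + (2 * Complex.I) • R) := isStarNormal_of_mem_unitary hR
  have hR_eq : R = (2 * Complex.I)⁻¹ • ((1 + (2 * Complex.I) • R) - 1) := by
    rw [add_sub_cancel_left, smul_smul, inv_mul_cancel₀ (by simp), one_smul]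
  rw [hR_eq]
  refine ⟨?_⟩
  rw [star_smul, star_sub, star_one]
  exact ((hU.star_comm_self.sub_left (Commute.one_left _)).sub_right
    (Commute.one_right _)).smul_left _ |>.smul_right _

lemma IsCayley.spectrum_subset (hR : IsCayley R) : spectrum ℂ R ⊆ resolventCircle := by
  intro w hw
  have hmem : 1 + (2 * Complex.I) * w ∈ spectrum ℂ (1 + (2 * Complex.I) • R) := by
    have hsmul := (spectrum.smul_mem_smul_iff (r := Units.mk0 (2 * Complex.I) (by simp))).2 hw
    have hadd := spectrum.add_mem_add_iff (s := (1 : ℂ)).2 hsmul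
    rwa [map_one, add_comm (_ • w)] at hadd
  have hnorm := spectrum.subset_circle_of_unitary hR hmem
  rw [mem_sphere_zero_iff_norm, ← sq_eq_sq₀ (norm_nonneg _) (by norm_num),
    ← Complex.normSq_eq_norm_sq, Complex.normSq_apply] at hnorm
  rw [mem_resolventCircle_iff, Complex.normSq_apply]
  simp only [Complex.add_re, Complex.one_re, Complex.mul_re, Complex.re_ofNat, Complex.I_re,
    mul_zero, Complex.im_ofNat, Complex.I_im, mul_one, sub_self, zero_mul, Complex.mul_im, add_zero,
    zero_sub, Complex.add_im, Complex.one_im, zero_add, one_pow] at hnorm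
  linarith

lemma IsCayley.star_mul (hR : IsCayley R) : star R * (1 + (2 * Complex.I) • R) = R := by
  have h := Unitary.star_mul_self_of_mem hR
  rw [star_add, star_one, star_smul, add_mul, one_mul, smul_mul_assoc, Complex.star_def, map_mul,
    Complex.conj_I, Complex.conj_ofNat] at h
  rw [add_assoc, add_eq_left, mul_neg, neg_smul, add_neg_eq_zero] at h
  exact (smul_right_injective 𝒜 (by simp : 2 * Complex.I ≠ 0) h).symm

lemma IsCayley.exists_partition_norm_sum_mul_le (hR : IsCayley R) {f : ℝ → ℂ}
    (hf : Continuous f) (hf0 : Tendsto f (cocompact ℝ) (𝓝 0)) {δ : ℝ} (hδ : 0 < δ) :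
    ∃ (t : Finset ℝ) (p : ℝ → C(spectrum ℂ R, ℂ)), ∑ x ∈ t, p x = 1 ∧
      ∀ (c : ℝ → C(spectrum ℂ R, ℂ)) {ε : ℝ}, 0 ≤ ε →
        (∀ (x : ℝ) (w : spectrum ℂ R), ‖(w : ℂ) - (u x)⁻¹‖ < δ →
          ‖resolventLift f w - f x‖ < δ → ‖c x w‖ ≤ ε) →
        ‖∑ x ∈ t, cfcHom hR.isStarNormal (c x) * cfcHom hR.isStarNormal (p x)‖ ≤ ε := by
  have hF := (continuousOn_resolventLift hf hf0).mono hR.spectrum_subset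
  obtain ⟨t, p, hp_sum, hp⟩ := RelTaylor.exists_partition_norm_sum_mul_le (X := spectrum ℂ R)
    (U := fun x : ℝ => {w | ‖(w : ℂ) - (u x)⁻¹‖ < δ} ∩ {w | ‖resolventLift f w - f x‖ < δ})
    (fun x => (isOpen_lt (continuous_subtype_val.sub continuous_const).norm continuous_const).inter
      (isOpen_lt (hF.domRestrict.sub continuous_const).norm continuous_const))
    (Set.iUnion_eq_univ_iff.2 fun w => exists_norm_sub_inv_u_lt hf0 (hR.spectrum_subset w.2) hδ)
  refine ⟨t, p, hp_sum, fun c ε hε hc => ?_⟩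
  simp only [← map_mul, ← map_sum]
  rw [norm_cfcHom R _ hR.isStarNormal]
  exact hp c hε fun x w hw => hc x w hw.1 hw.2

/-- Finite approximate resolutions come from a partition of unity on the spectrum of `R` that is
fine enough for the functions `w` and `resolventLift f w` to be almost constant on its pieces. -/
lemma IsCayley.exists_isApproxResolution (hR : IsCayley R) {f : ℝ → ℂ} (hf : Continuous f)
    (hf0 : Tendsto f (cocompact ℝ) (𝓝 0)) {δ : ℝ} (hδ : 0 < δ) :
    ∃ t P, IsApproxResolution R δ t P ∧ ‖cfc (resolventLift f) R - ∑ x ∈ t, f x • P x‖ ≤ δ := by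
  obtain ⟨t, p, hp_sum, norm_sum_le⟩ := hR.exists_partition_norm_sum_mul_le hf hf0 hδ
  let Φ := cfcHom (R := ℂ) hR.isStarNormal
  let ident : C(spectrum ℂ R, ℂ) := (ContinuousMap.id ℂ).restrict (spectrum ℂ R)
  have hΦ_id : Φ ident = R := cfcHom_id hR.isStarNormal
  have norm_exp : ∀ y x : ℝ, ‖Complex.exp (Complex.I * (y * x : ℝ))‖ = 1 := fun y x => by
    rw [mul_comm, Complex.norm_exp_ofReal_mul_I]
  refine ⟨t, fun x => Φ (p x), ⟨?_, fun x => ?_, fun y => ?_, fun y => ?_⟩, ?_⟩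
  · rw [← map_sum, hp_sum, map_one]
  · nth_rw 1 [← hΦ_id]
    exact (Commute.all ident (p x)).map Φ
  · simp only [Algebra.smul_def, ← AlgHomClass.commutes Φ]
    exact norm_sum_le _ zero_le_one fun x w _ _ => (norm_exp y x).le
  · have smul_sub_mul : ∀ (z w : ℂ) (q : C(spectrum ℂ R, ℂ)), z • ((R - algebraMap ℂ 𝒜 w) * Φ q)
        = Φ (z • (ident - algebraMap ℂ _ w)) * Φ q := fun z w q => by
      rw [map_smul, map_sub, hΦ_id, AlgHomClass.commutes, smul_mul_assoc]
    simp only [smul_sub_mul]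
    refine norm_sum_le _ hδ.le fun x w hw _ => ?_
    rw [ContinuousMap.smul_apply, norm_smul, norm_exp, one_mul]
    exact hw.le
  · have hF := (continuousOn_resolventLift hf hf0).mono hR.spectrum_subset
    rw [cfc_apply _ R hR.isStarNormal hF]
    let F : C(spectrum ℂ R, ℂ) := ⟨_, hF.domRestrict⟩
    have sub_sum_eq : Φ F - ∑ x ∈ t, f x • Φ (p x)
        = ∑ x ∈ t, Φ (F - algebraMap ℂ _ (f x)) * Φ (p x) := by
      simp only [map_sub, sub_mul, AlgHomClass.commutes, ← Algebra.smul_def,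
        Finset.sum_sub_distrib]
      rw [← Finset.mul_sum, ← map_sum, hp_sum, map_one, mul_one]
    exact sub_sum_eq ▸ norm_sum_le _ hδ.le fun x w _ hw => hw.le

end CStarAlgebra

/-! ### The noncommutative Taylor formula -/

section ApproximateTaylor

variable {𝒜 ι : Type*} [NormedRing 𝒜] [NormedAlgebra ℂ 𝒜]

lemma ExpSumBound.mul_const {s : Finset ι} {m : ι → List ℝ} {Z : ι → 𝒜} {M : ℝ}
    (hM : ExpSumBound s m Z M) (K : 𝒜) : ExpSumBound s m (fun k => Z k * K) (M * ‖K‖) := fun y => by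
  simpa only [Finset.sum_mul, smul_mul_assoc] using norm_mul_le_of_le (hM y) (le_refl ‖K‖)

lemma ExpSumBound.mul_append {s : Finset ι} {t : Finset ℝ} {m : ι → List ℝ} {Z : ι → 𝒜}
    {B : ℝ → 𝒜} {q : ℕ} {M b : ℝ} (hM : ExpSumBound s m Z M) (hm : ∀ k, (m k).length = q)
    (hB : ∀ y : ℝ, ‖∑ x ∈ t, Complex.exp (Complex.I * (y * x : ℝ)) • B x‖ ≤ b) :
    ExpSumBound (s ×ˢ t) (fun k => m k.1 ++ [k.2]) (fun k => Z k.1 * B k.2) (M * b) := fun y => by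
  simpa only [Finset.sum_product, Finset.sum_mul_sum, phase_append_singleton, hm,
    Complex.ofReal_add, mul_add, Complex.exp_add, smul_mul_smul_comm]
    using norm_mul_le_of_le (hM y) (hB (y q))

lemma ExpSumBound.remove_fst {s : Finset ι} {a : ι → ℝ} {m : ι → List ℝ} {Z : ι → 𝒜} {M : ℝ}
    (hM : ExpSumBound s (fun k => a k :: m k) Z M) : ExpSumBound s m Z M := fun y => by
  convert hM fun n => match n with
    | 0 => 0
    | n + 1 => y n using 7 with k
  simp only [phase]
  ring

lemma ExpSumBound.remove_snd {s : Finset ι} {a b : ι → ℝ} {m : ι → List ℝ} {Z : ι → 𝒜} {M : ℝ}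
    (hM : ExpSumBound s (fun k => a k :: b k :: m k) Z M) :
    ExpSumBound s (fun k => a k :: m k) Z M := by
  simpa using ExpSumBound.cons_segment (x := a) (a := b) hM 1

/-- The sum `∑ χ(x₁, …, x_p) A₁ ⋯ A_n` over all the words in which each letter `A_j` is `-K` or one
of the `K P x`, where `x₁, …, x_p` are the points that occur in the word. It discretizes a multiple
operator integral. -/
def wordSum (K : 𝒜) (t : Finset ℝ) (P : ℝ → 𝒜) : ℕ → (List ℝ → ℂ) →ₗ[ℂ] 𝒜
  | 0 => (LinearMap.proj []).smulRight 1
  | n + 1 => ∑ x ∈ t, LinearMap.mulLeft ℂ (K * P x) ∘ₗ wordSum K t P n ∘ₗ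
      LinearMap.funLeft ℂ ℂ (x :: ·) - LinearMap.mulLeft ℂ K ∘ₗ wordSum K t P n

lemma wordSum_zero (K : 𝒜) (t : Finset ℝ) (P : ℝ → 𝒜) (χ : List ℝ → ℂ) :
    wordSum K t P 0 χ = χ [] • (1 : 𝒜) := rfl

lemma wordSum_succ (K : 𝒜) (t : Finset ℝ) (P : ℝ → 𝒜) (n : ℕ) (χ : List ℝ → ℂ) :
    wordSum K t P (n + 1) χ
      = ∑ x ∈ t, K * P x * wordSum K t P n (fun l => χ (x :: l)) - K * wordSum K t P n χ := by
  simp only [wordSum, LinearMap.sub_apply, LinearMap.sum_apply]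
  rfl

lemma wordSum_smul (c : ℂ) (K : 𝒜) (t : Finset ℝ) (P : ℝ → 𝒜) (n : ℕ) (χ : List ℝ → ℂ) :
    wordSum (c • K) t P n χ = c ^ n • wordSum K t P n χ := by
  induction n generalizing χ with
  | zero => simp [wordSum_zero]
  | succ n ih =>
    simp only [wordSum_succ, ih, smul_mul_assoc, mul_smul_comm, smul_smul, pow_succ,
      ← Finset.smul_sum, smul_sub]

/-- The approximation `∑ Q x * wordSum … (weightedDiff f x)` of the `n`-th Taylor term, when `P = Q`
imitates the spectral projections of the unperturbed operator; with those of the perturbed operator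
as `Q` it approximates the remainder of order `n`. -/
def taylorSum (f : ℝ → ℂ) (K : 𝒜) (t : Finset ℝ) (P : ℝ → 𝒜) (s : Finset ℝ) (Q : ℝ → 𝒜) (n : ℕ) :
    𝒜 :=
  ∑ x ∈ s, Q x * wordSum K t P n (weightedDiff f x)

lemma taylorSum_zero (f : ℝ → ℂ) (K : 𝒜) (t : Finset ℝ) (P : ℝ → 𝒜) (s : Finset ℝ) (Q : ℝ → 𝒜) :
    taylorSum f K t P s Q 0 = ∑ x ∈ s, f x • Q x := by
  simp only [taylorSum, wordSum_zero, weightedDiff_nil, mul_smul_comm, mul_one]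

lemma taylorSum_smul (f : ℝ → ℂ) (c : ℂ) (K : 𝒜) (t : Finset ℝ) (P : ℝ → 𝒜) (s : Finset ℝ)
    (Q : ℝ → 𝒜) (n : ℕ) :
    taylorSum f (c • K) t P s Q n = c ^ n • taylorSum f K t P s Q n := by
  simp only [taylorSum, wordSum_smul, mul_smul_comm, Finset.smul_sum]

/-- The terms that are subtracted from `R` and `S` on the right cancel in the sum, by the recursion
for the weighted divided differences. -/
lemma mul_taylorSum_sub_eq {f : ℝ → ℂ} (hf : ContDiff ℝ ∞ f) {R S K : 𝒜}
    (hRS : R - S = S * K) {t s : Finset ℝ} {P Q : ℝ → 𝒜} (hP : ∑ x ∈ t, P x = 1)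
    (hQ : ∑ x ∈ s, Q x = 1) (hSQ : ∀ x, Commute S (Q x)) (n : ℕ) :
    S * (taylorSum f K t P s Q n - taylorSum f K t P t P n - taylorSum f K t P s Q (n + 1))
      = ∑ k ∈ s ×ˢ t, (Q k.1 * ((R - algebraMap ℂ 𝒜 (u k.2)⁻¹) * P k.2) *
            (wordSum K t P n (weightedDiff f k.1)
              - wordSum K t P n (fun l => weightedDiff f k.1 (k.2 :: l)))
          + (S - algebraMap ℂ 𝒜 (u k.1)⁻¹) * Q k.1 * P k.2 *
            (wordSum K t P n (fun l => weightedDiff f k.1 (k.2 :: l))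
              - wordSum K t P n (weightedDiff f k.2))) := by
  set W : ℝ → 𝒜 := fun x => wordSum K t P n (weightedDiff f x) with hW
  set V : ℝ → ℝ → 𝒜 := fun x z => wordSum K t P n (fun l => weightedDiff f x (z :: l)) with hV
  have recursion : ∀ x z, ((u z)⁻¹ - (u x)⁻¹) • V x z = (u z)⁻¹ • W x - (u x)⁻¹ • W z := by
    intro x z
    simp only [hW, hV, ← map_smul, ← map_sub]
    congr 1
    ext l
    exact sub_inv_u_mul_weightedDiff_cons hf x z l
  have sum_fst : taylorSum f K t P s Q n = ∑ k ∈ s ×ˢ t, Q k.1 * P k.2 * W k.1 := by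
    simp only [taylorSum, Finset.sum_product, ← Finset.sum_mul, ← Finset.mul_sum, hP, mul_one, hW]
  have sum_snd : taylorSum f K t P t P n = ∑ k ∈ s ×ˢ t, Q k.1 * P k.2 * W k.2 := by
    simp only [taylorSum, Finset.sum_product_right, ← Finset.sum_mul, hQ, one_mul, hW]
  have sum_succ : taylorSum f K t P s Q (n + 1)
      = ∑ k ∈ s ×ˢ t, Q k.1 * K * P k.2 * (V k.1 k.2 - W k.1) := by
    simp only [taylorSum, wordSum_succ, Finset.sum_product, mul_sub, Finset.sum_sub_distrib,
      mul_assoc, ← Finset.mul_sum]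
    simp only [← Finset.sum_mul, hP, one_mul, hW, hV]
  rw [sum_fst, sum_snd, sum_succ, ← Finset.sum_sub_distrib, ← Finset.sum_sub_distrib,
    Finset.mul_sum]
  refine Finset.sum_congr rfl fun ⟨x, z⟩ _ => ?_
  have hSQK : S * (Q x * K) = Q x * (R - S) := by
    rw [← mul_assoc, (hSQ x).eq, mul_assoc, hRS]
  have cancel : (u z)⁻¹ • (W x - V x z) + (u x)⁻¹ • (V x z - W z) = 0 := by
    linear_combination (norm := module) (-1 : ℂ) • recursion x z
  calc S * (Q x * P z * W x - Q x * P z * W z - Q x * K * P z * (V x z - W x))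
      = S * Q x * P z * (W x - W z) - S * (Q x * K) * P z * (V x z - W x) := by noncomm_ring
    _ = Q x * R * P z * (W x - V x z) + S * Q x * P z * (V x z - W z)
        - Q x * P z * ((u z)⁻¹ • (W x - V x z) + (u x)⁻¹ • (V x z - W z)) := by
      rw [hSQK, (hSQ x).eq, cancel]
      noncomm_ring
    _ = Q x * ((R - algebraMap ℂ 𝒜 (u z)⁻¹) * P z) * (W x - V x z)
        + (S - algebraMap ℂ 𝒜 (u x)⁻¹) * Q x * P z * (V x z - W z) := by
      simp only [sub_mul, mul_sub, ← Algebra.smul_def, smul_mul_assoc, mul_smul_comm, mul_add,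
        mul_assoc, smul_sub]
      abel

/-- The constants `∑ (n choose p) |μ_{q+p}|(ℝ) / (q+p)!`, summed over `p ≤ n` through Pascal's rule.
For `q = 0` and the measures `μ p` that represent `(f uᵖ)⁽ᵖ⁾`, they occur as the bounds for the
`n`-th Taylor term and for the remainder of order `n`. -/
def taylorConst (μ : ℕ → ComplexMeasure ℝ) : ℕ → ℕ → ℝ
  | 0, q => (μ q).variation.real Set.univ / q.factorial
  | n + 1, q => taylorConst μ n (q + 1) + taylorConst μ n q

lemma taylorConst_nonneg (μ : ℕ → ComplexMeasure ℝ) (n q : ℕ) : 0 ≤ taylorConst μ n q := by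
  induction n generalizing q with
  | zero => exact div_nonneg measureReal_nonneg (Nat.cast_nonneg _)
  | succ n ih => exact add_nonneg (ih _) (ih _)

variable [CompleteSpace 𝒜] {f : ℝ → ℂ} {μ : ℕ → ComplexMeasure ℝ}

lemma norm_sum_mul_wordSum_le (hf : ContDiff ℝ ∞ f)
    (hμ : ∀ p, IsFourierOf (weightedDeriv f p) (μ p)) {t : Finset ℝ} {P : ℝ → 𝒜}
    (hP : ∀ y : ℝ, ‖∑ x ∈ t, Complex.exp (Complex.I * (y * x : ℝ)) • P x‖ ≤ 1) (K : 𝒜) (n : ℕ)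
    {s : Finset ι} {Z : ι → 𝒜} {x : ι → ℝ} {m : ι → List ℝ} {q : ℕ} (hm : ∀ k, (m k).length = q)
    {M : ℝ} (hM : ExpSumBound s (fun k => x k :: m k) Z M) :
    ‖∑ k ∈ s, Z k * wordSum K t P n (fun l => weightedDiff f (x k) (m k ++ l))‖
      ≤ M * ‖K‖ ^ n * taylorConst μ n q := by
  induction n generalizing ι q M with
  | zero =>
    simpa [wordSum_zero, taylorConst] using norm_sum_weightedDiff_smul_le hf (hμ q) hm hM
  | succ n ih =>
    have hMK := hM.mul_const K
    have split_sum : ∑ k ∈ s, Z k * wordSum K t P (n + 1) (fun l => weightedDiff f (x k) (m k ++ l))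
        = ∑ k ∈ s ×ˢ t, Z k.1 * K * P k.2 *
            wordSum K t P n (fun l => weightedDiff f (x k.1) (m k.1 ++ [k.2] ++ l))
          - ∑ k ∈ s, Z k * K * wordSum K t P n (fun l => weightedDiff f (x k) (m k ++ l)) := by
      simp only [wordSum_succ, mul_sub, Finset.mul_sum, Finset.sum_sub_distrib,
        Finset.sum_product, List.append_assoc, List.cons_append, List.nil_append, mul_assoc]
    rw [split_sum]
    refine (norm_sub_le_of_le
      (ih (q := q + 1) (fun k => by simp [hm])
        (hMK.mul_append (q := q + 1) (fun k => by simp [hm]) hP))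
      (ih hm hMK)).trans_eq ?_
    rw [taylorConst]
    ring

lemma norm_mul_taylorSum_sub_le (hf : ContDiff ℝ ∞ f)
    (hμ : ∀ p, IsFourierOf (weightedDeriv f p) (μ p)) {R S K : 𝒜} (hRS : R - S = S * K) {δ : ℝ}
    {t s : Finset ℝ} {P Q : ℝ → 𝒜} (hP : IsApproxResolution R δ t P)
    (hQ : IsApproxResolution S δ s Q) (n : ℕ) :
    ‖S * (taylorSum f K t P s Q n - taylorSum f K t P t P n - taylorSum f K t P s Q (n + 1))‖
      ≤ δ * (2 * ‖K‖ ^ n * (taylorConst μ n 0 + taylorConst μ n 1)) := by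
  have hQ_exp : ExpSumBound s (fun x => [x]) Q 1 := fun y => by
    simpa [phase] using hQ.norm_sum_exp_le (y 0)
  have hSQ_exp : ExpSumBound s (fun x => [x]) (fun x => (S - algebraMap ℂ 𝒜 (u x)⁻¹) * Q x) δ :=
    fun y => by simpa [phase] using hQ.norm_sum_exp_sub_le (y 0)
  have hA := hQ_exp.mul_append (fun _ => rfl) hP.norm_sum_exp_sub_le
  have hB := hSQ_exp.mul_append (fun _ => rfl) hP.norm_sum_exp_le
  rw [one_mul] at hA
  rw [mul_one] at hB
  have bound_zero := fun {Z M} {x : ℝ × ℝ → ℝ} => norm_sum_mul_wordSum_le hf hμ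
    hP.norm_sum_exp_le K n (s := s ×ˢ t) (Z := Z) (x := x) (m := fun _ => []) (q := 0)
    (fun _ => rfl) (M := M)
  have bound_one := fun {Z M} => norm_sum_mul_wordSum_le hf hμ
    hP.norm_sum_exp_le K n (s := s ×ˢ t) (Z := Z) (x := Prod.fst) (m := fun k => [k.2]) (q := 1)
    (fun _ => rfl) (M := M)
  rw [mul_taylorSum_sub_eq hf hRS hP.sum_eq_one hQ.sum_eq_one hQ.commute]
  simp only [mul_sub, Finset.sum_add_distrib, Finset.sum_sub_distrib]
  refine (norm_add_le_of_le
    (norm_sub_le_of_le (bound_zero hA.remove_snd) (bound_one hA))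
    (norm_sub_le_of_le (bound_one hB) (bound_zero hB.remove_fst))).trans_eq ?_
  ring

lemma norm_taylorSum_le (hf : ContDiff ℝ ∞ f)
    (hμ : ∀ p, IsFourierOf (weightedDeriv f p) (μ p)) (K : 𝒜) {R S : 𝒜} {δ : ℝ}
    {t s : Finset ℝ} {P Q : ℝ → 𝒜} (hP : IsApproxResolution R δ t P)
    (hQ : IsApproxResolution S δ s Q) (n : ℕ) :
    ‖taylorSum f K t P s Q n‖ ≤ ‖K‖ ^ n * taylorConst μ n 0 := by
  have hQ_exp : ExpSumBound s (fun x => [x]) Q 1 := fun y => by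
    simpa [phase] using hQ.norm_sum_exp_le (y 0)
  have h := norm_sum_mul_wordSum_le hf hμ hP.norm_sum_exp_le K n (m := fun _ => []) (fun _ => rfl)
    hQ_exp
  rwa [one_mul] at h

lemma exists_norm_mul_sum_sub_taylorSum_le (hf : ContDiff ℝ ∞ f)
    (hμ : ∀ p, IsFourierOf (weightedDeriv f p) (μ p)) {R S K : 𝒜} (hRS : R - S = S * K) (n : ℕ) :
    ∃ C, ∀ {δ : ℝ} {t s : Finset ℝ} {P Q : ℝ → 𝒜}, IsApproxResolution R δ t P →
      IsApproxResolution S δ s Q →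
      ‖S * (∑ x ∈ s, f x • Q x - ∑ k ∈ Finset.range n, taylorSum f K t P t P k
        - taylorSum f K t P s Q n)‖ ≤ δ * C := by
  refine ⟨∑ k ∈ Finset.range n, 2 * ‖K‖ ^ k * (taylorConst μ k 0 + taylorConst μ k 1),
    fun {δ t s P Q} hP hQ => ?_⟩
  have telescope : ∑ x ∈ s, f x • Q x - ∑ k ∈ Finset.range n, taylorSum f K t P t P k
        - taylorSum f K t P s Q n
      = ∑ k ∈ Finset.range n, (taylorSum f K t P s Q k - taylorSum f K t P t P k
        - taylorSum f K t P s Q (k + 1)) := by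
    simp only [sub_right_comm _ (taylorSum f K t P t P _)]
    rw [Finset.sum_sub_distrib, Finset.sum_range_sub', taylorSum_zero]
    abel
  rw [telescope, Finset.mul_sum, Finset.mul_sum]
  exact norm_sum_le_of_le _ fun k _ => norm_mul_taylorSum_sub_le hf hμ hRS hP hQ k

end ApproximateTaylor

section WeakLimit

variable {E : Type*} [NormedAddCommGroup E] [InnerProductSpace ℂ E] [CompleteSpace E]

lemma exists_tendsto_inner {ι : Type*} (𝒰 : Ultrafilter ι) (T : ι → E →L[ℂ] E) {M : ℝ}
    (hM : ∀ i, ‖T i‖ ≤ M) :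
    ∃ L : E →L[ℂ] E, ∀ ψ φ, Tendsto (fun i => inner ℂ (T i ψ) φ) 𝒰 (𝓝 (inner ℂ (L ψ) φ)) := by
  have norm_inner_le : ∀ i ψ φ, ‖inner ℂ (T i ψ) φ‖ ≤ M * ‖ψ‖ * ‖φ‖ := fun i ψ φ =>
    (norm_inner_le_norm _ _).trans
      (mul_le_mul_of_nonneg_right ((T i).le_of_opNorm_le (hM i) ψ) (norm_nonneg _))
  have exists_limit : ∀ ψ φ, ∃ z : ℂ, ‖z‖ ≤ M * ‖ψ‖ * ‖φ‖ ∧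
      Tendsto (fun i => inner ℂ (T i ψ) φ) 𝒰 (𝓝 z) := by
    intro ψ φ
    obtain ⟨z, hz, hz_lim⟩ := (isCompact_closedBall (0 : ℂ) (M * ‖ψ‖ * ‖φ‖)).ultrafilter_le_nhds'
      (𝒰.map fun i => inner ℂ (T i ψ) φ) (by
        rw [Ultrafilter.mem_map]
        exact Filter.univ_mem' fun i => by simpa using norm_inner_le i ψ φ)
    exact ⟨z, by simpa using hz, hz_lim⟩
  choose q hq q_lim using exists_limit
  let form : E →ₗ⋆[ℂ] E →ₗ[ℂ] ℂ := LinearMap.mk₂'ₛₗ (starRingEnd ℂ) (RingHom.id ℂ) q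
    (fun x y z => tendsto_nhds_unique (q_lim _ _)
      (((q_lim x z).add (q_lim y z)).congr fun i => by rw [map_add, inner_add_left]))
    (fun c x y => tendsto_nhds_unique (q_lim _ _)
      (((q_lim x y).const_mul (starRingEnd ℂ c)).congr fun i => by
        rw [map_smul, inner_smul_left]))
    (fun x y z => tendsto_nhds_unique (q_lim _ _)
      (((q_lim x y).add (q_lim x z)).congr fun i => by rw [inner_add_right]))
    (fun c x y => tendsto_nhds_unique (q_lim _ _)
      (((q_lim x y).const_mul c).congr fun i => by rw [inner_smul_right]))
  refine ⟨InnerProductSpace.continuousLinearMapOfBilin (LinearMap.mkContinuous₂ form M hq),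
    fun ψ φ => ?_⟩
  rw [InnerProductSpace.continuousLinearMapOfBilin_apply]
  exact q_lim ψ φ

/-- Since the limit is only tested on the dense range of the adjoint of `S`, it is enough that the
operators `X i` become close to `Y i` after multiplication by `S`. -/
lemma norm_le_of_tendsto_inner {ι : Type*} {l : Filter ι} [l.NeBot] {X Y : ι → E →L[ℂ] E}
    {L S : E →L[ℂ] E} (hX : ∀ ψ φ, Tendsto (fun i => inner ℂ (X i ψ) φ) l (𝓝 (inner ℂ (L ψ) φ)))
    (hS : DenseRange (star S : E →L[ℂ] E)) (hXY : Tendsto (fun i => ‖S * (X i - Y i)‖) l (𝓝 0))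
    {M : ℝ} (hY : ∀ i, ‖Y i‖ ≤ M) : ‖L‖ ≤ M := by
  have hM : 0 ≤ M := (norm_nonneg _).trans (hY (l.nonempty_of_mem univ_mem).some)
  have inner_le_on_range : ∀ ψ φ, ‖inner ℂ (L ψ) ((star S : E →L[ℂ] E) φ)‖
      ≤ M * ‖ψ‖ * ‖(star S : E →L[ℂ] E) φ‖ := by
    intro ψ φ
    have norm_inner_le : ∀ i, ‖inner ℂ (X i ψ) ((star S : E →L[ℂ] E) φ)‖
        ≤ ‖S * (X i - Y i)‖ * ‖ψ‖ * ‖φ‖ + M * ‖ψ‖ * ‖(star S : E →L[ℂ] E) φ‖ := fun i => by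
      have split : inner ℂ (X i ψ) ((star S : E →L[ℂ] E) φ)
          = inner ℂ ((S * (X i - Y i)) ψ) φ + inner ℂ (Y i ψ) ((star S : E →L[ℂ] E) φ) := by
        simp only [ContinuousLinearMap.star_eq_adjoint, ContinuousLinearMap.adjoint_inner_right,
          mul_sub, mul_apply_eq_comp, sub_apply, inner_sub_left, sub_add_cancel]
      rw [split]
      exact norm_add_le_of_le
        ((norm_inner_le_norm _ _).trans (by gcongr; exact ContinuousLinearMap.le_opNorm _ _))
        ((norm_inner_le_norm _ _).trans (by gcongr; exact (Y i).le_of_opNorm_le (hY i) ψ))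
    refine le_of_tendsto_of_tendsto' (hX ψ _).norm ?_ norm_inner_le
    simpa only [zero_mul, zero_add] using ((hXY.mul_const ‖ψ‖).mul_const ‖φ‖).add_const _
  have inner_le : ∀ ψ φ, ‖inner ℂ (L ψ) φ‖ ≤ M * ‖ψ‖ * ‖φ‖ := fun ψ φ =>
    hS.induction_on φ (isClosed_le (by fun_prop) (by fun_prop)) (inner_le_on_range ψ)
  refine L.opNorm_le_of_re_inner_le hM fun ψ φ hψ hφ => ?_
  simpa only [hψ, hφ, mul_one] using (RCLike.re_le_norm _).trans (inner_le ψ φ)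

end WeakLimit

section CayleyTaylor

variable {E : Type*} [NormedAddCommGroup E] [InnerProductSpace ℂ E] [CompleteSpace E]

lemma IsCayley.denseRange_star {S : E →L[ℂ] E} (hS : IsCayley S) (hS_dense : DenseRange S) :
    DenseRange (star S : E →L[ℂ] E) := by
  refine hS_dense.mono ?_
  nth_rw 1 [← hS.star_mul]
  exact Set.range_comp_subset_range (1 + (2 * Complex.I) • S : E →L[ℂ] E) (star S : E →L[ℂ] E)

theorem IsCayley.exists_taylor {R K : E →L[ℂ] E} (hR : IsCayley R) {f : ℝ → ℂ}
    (hf : ContDiff ℝ ∞ f) (hf0 : Tendsto f (cocompact ℝ) (𝓝 0)) {μ : ℕ → ComplexMeasure ℝ}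
    (hμ : ∀ p, IsFourierOf (weightedDeriv f p) (μ p)) :
    ∃ T : ℕ → E →L[ℂ] E, (∀ n, ‖T n‖ ≤ ‖K‖ ^ n * taylorConst μ n 0) ∧
      ∀ (c : ℂ) (S : E →L[ℂ] E), IsCayley S → DenseRange S → R - S = c • (S * K) → ∀ n,
        ‖cfc (resolventLift f) S - ∑ k ∈ Finset.range n, c ^ k • T k‖
          ≤ ‖c‖ ^ n * ‖K‖ ^ n * taylorConst μ n 0 := by
  have hδ : ∀ i : ℕ, (0 : ℝ) < 1 / (i + 1) := fun i => Nat.one_div_pos_of_nat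
  have hδ_lim : Tendsto (fun i : ℕ => (1 : ℝ) / (i + 1)) (hyperfilter ℕ) (𝓝 0) :=
    tendsto_one_div_add_atTop_nhds_zero_nat.mono_left Nat.hyperfilter_le_atTop
  choose t P hP _ using fun i => hR.exists_isApproxResolution hf.continuous hf0 (hδ i)
  choose T hT using fun n => exists_tendsto_inner (hyperfilter ℕ)
    (fun i => taylorSum f K (t i) (P i) (t i) (P i) n)
    fun i => norm_taylorSum_le hf hμ K (hP i) (hP i) n
  refine ⟨T, fun n => norm_le_of_tendsto_inner (S := 1) (hT n) ?_ (by simp)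
    fun i => norm_taylorSum_le hf hμ K (hP i) (hP i) n, fun c S hS hS_dense hRS n => ?_⟩
  · rw [star_one]
    exact Function.surjective_id.denseRange
  choose s Q hQ hSQ using fun i => hS.exists_isApproxResolution hf.continuous hf0 (hδ i)
  rw [← mul_smul_comm] at hRS
  obtain ⟨C, hC⟩ := exists_norm_mul_sum_sub_taylorSum_le hf hμ hRS n
  rw [← mul_pow, ← norm_smul]
  refine norm_le_of_tendsto_inner (l := hyperfilter ℕ) (S := S)
    (X := fun i => cfc (resolventLift f) S - ∑ k ∈ Finset.range n,
      c ^ k • taylorSum f K (t i) (P i) (t i) (P i) k)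
    (Y := fun i => taylorSum f (c • K) (t i) (P i) (s i) (Q i) n) (fun ψ φ => ?_)
    (hS.denseRange_star hS_dense) ?_ fun i => norm_taylorSum_le hf hμ (c • K) (hP i) (hQ i) n
  · simp only [sub_apply, sum_apply, smul_apply, inner_sub_left,
      sum_inner, inner_smul_left]
    exact tendsto_const_nhds.sub (tendsto_finsetSum _ fun k _ => (hT k ψ φ).const_mul _)
  · refine squeeze_zero (fun _ => norm_nonneg _)
      (g := fun i : ℕ => ‖S‖ * (1 / (i + 1)) + 1 / (i + 1) * C)
      (fun i => ?_) (by simpa using (hδ_lim.const_mul ‖S‖).add (hδ_lim.mul_const C))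
    have split : S * (cfc (resolventLift f) S - ∑ k ∈ Finset.range n,
          c ^ k • taylorSum f K (t i) (P i) (t i) (P i) k
          - taylorSum f (c • K) (t i) (P i) (s i) (Q i) n)
        = S * (cfc (resolventLift f) S - ∑ x ∈ s i, f x • Q i x)
          + S * (∑ x ∈ s i, f x • Q i x - ∑ k ∈ Finset.range n,
            taylorSum f (c • K) (t i) (P i) (t i) (P i) k
          - taylorSum f (c • K) (t i) (P i) (s i) (Q i) n) := by
      simp only [taylorSum_smul]
      noncomm_ring
    rw [split]
    exact norm_add_le_of_le (norm_mul_le_of_le le_rfl (hSQ i)) (hC (hP i) (hQ i))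

end CayleyTaylor

/-! ### The converse of Taylor's theorem -/

section ConverseTaylor

variable {Y : Type*} [NormedAddCommGroup Y] [NormedSpace ℝ Y]

variable (Y) in
lemma exists_norm_coeff_le (n : ℕ) :
    ∃ C : ℝ, ∀ (e : ℕ → Y) (ε : ℝ),
      (∀ i < n, ‖∑ j ∈ Finset.range n, (i : ℝ) ^ j • e j‖ ≤ ε) → ∀ k < n, ‖e k‖ ≤ C * ε := by
  let W : Matrix (Fin n) (Fin n) ℝ := Matrix.vandermonde fun i => ((i : ℕ) : ℝ)
  have hW : IsUnit W.det := isUnit_iff_ne_zero.2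
    (Matrix.det_vandermonde_ne_zero_iff.2 fun i j h => Fin.ext (Nat.cast_injective h))
  refine ⟨∑ k, ∑ i, |W⁻¹ k i|, fun e ε he k hk => ?_⟩
  have interpolate : e k
      = ∑ i, W⁻¹ ⟨k, hk⟩ i • ∑ j ∈ Finset.range n, ((i : ℕ) : ℝ) ^ j • e j := by
    have inv_mul_apply : ∀ j : Fin n, ∑ i : Fin n, W⁻¹ ⟨k, hk⟩ i * ((i : ℕ) : ℝ) ^ (j : ℕ)
        = (1 : Matrix (Fin n) (Fin n) ℝ) ⟨k, hk⟩ j := fun j => by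
      rw [← Matrix.nonsing_inv_mul W hW, Matrix.mul_apply]
      rfl
    simp only [Finset.smul_sum, smul_smul, Finset.sum_range]
    rw [Finset.sum_comm]
    simp [← Finset.sum_smul, inv_mul_apply, Matrix.one_apply]
  calc ‖e k‖ ≤ ∑ i, |W⁻¹ ⟨k, hk⟩ i| * ε := by
        rw [interpolate]
        exact norm_sum_le_of_le _ fun i _ => (norm_smul_le _ _).trans
          (mul_le_mul_of_nonneg_left (he i i.2) (abs_nonneg _))
    _ ≤ (∑ k, ∑ i, |W⁻¹ k i|) * ε := by
        rw [← Finset.sum_mul]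
        refine mul_le_mul_of_nonneg_right ?_ ((norm_nonneg _).trans (he k hk))
        exact Finset.single_le_sum (f := fun k => ∑ i, |W⁻¹ k i|)
          (fun k _ => Finset.sum_nonneg fun i _ => abs_nonneg _) (Finset.mem_univ (⟨k, hk⟩ : Fin n))

lemma sum_add_one_mul_pow_smul (n : ℕ) (c x : ℝ) (e : ℕ → Y) :
    ∑ j ∈ Finset.range n, ((c + 1) * x) ^ j • e j
      = ∑ p ∈ Finset.range n, c ^ p • ∑ j ∈ Finset.range n, (j.choose p * x ^ j) • e j := by
  have binomial : ∀ j ∈ Finset.range n,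
      (c + 1) ^ j = ∑ p ∈ Finset.range n, c ^ p * j.choose p := fun j hj => by
    simp only [add_pow, one_pow, mul_one]
    refine Finset.sum_subset (Finset.range_subset_range.2
      (Nat.succ_le_of_lt (Finset.mem_range.1 hj))) fun p _ hp => ?_
    rw [Nat.choose_eq_zero_of_lt (by simpa using hp), Nat.cast_zero, mul_zero]
  simp only [Finset.smul_sum, smul_smul]
  rw [Finset.sum_comm]
  refine Finset.sum_congr rfl fun j hj => ?_
  simp only [mul_pow, binomial j hj, Finset.sum_mul, Finset.sum_smul, mul_assoc]

/-- On the interval `(-r, r)` the function `F` has at every point `t` Taylor polynomials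
`∑ sᵏ aₖ(t)` of all orders `n`, with errors bounded by `Mₙ |s|ⁿ` uniformly in `t`. -/
def HasUniformTaylor (F : ℝ → Y) (a : ℕ → ℝ → Y) (M : ℕ → ℝ) (r : ℝ) : Prop :=
  ∀ t s : ℝ, |t| < r → |t + s| < r → ∀ n,
    ‖F (t + s) - ∑ k ∈ Finset.range n, s ^ k • a k t‖ ≤ M n * |s| ^ n

namespace HasUniformTaylor

variable {F : ℝ → Y} {a : ℕ → ℝ → Y} {M : ℕ → ℝ} {r : ℝ}

/-- The expansions of `F (t + (i + 1) * x)` around `t` and around `t + x` are two polynomials in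
`i`, whose coefficients can be compared as they are close for `i = 0, …, n - 1`. -/
lemma exists_norm_pow_smul_sub_le (h : HasUniformTaylor F a M r) (n : ℕ) :
    ∃ D, ∀ t x : ℝ, n * |x| < r - |t| → ∀ k < n,
      ‖x ^ k • a k (t + x) - ∑ j ∈ Finset.range n, (j.choose k * x ^ j) • a j t‖ ≤ D * |x| ^ n := by
  obtain ⟨C, hC⟩ := exists_norm_coeff_le Y n
  refine ⟨C * (2 * |M n| * n ^ n), fun t x hx k hk => ?_⟩
  have abs_add_lt : ∀ c : ℝ, 0 ≤ c → c ≤ n → |t + c * x| < r := fun c hc hcn => by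
    have := mul_le_mul_of_nonneg_right hcn (abs_nonneg x)
    have := abs_add_le t (c * x)
    rw [abs_mul, abs_of_nonneg hc] at this
    linarith
  have error_le : ∀ c : ℝ, 0 ≤ c → c ≤ n → M n * |c * x| ^ n ≤ |M n| * n ^ n * |x| ^ n :=
    fun c hc hcn => by
      rw [abs_mul, mul_pow, abs_of_nonneg hc, ← mul_assoc]
      gcongr
      exact le_abs_self _
  rw [mul_assoc]
  refine hC (fun k => x ^ k • a k (t + x) - ∑ j ∈ Finset.range n, (j.choose k * x ^ j) • a j t) _
    (fun i hi => ?_) k hk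
  have hi_succ : (i : ℝ) + 1 ≤ n := by exact_mod_cast hi
  have hi_nonneg : (0 : ℝ) ≤ i := i.cast_nonneg
  have two_expansions : ∑ k ∈ Finset.range n, (i : ℝ) ^ k • (x ^ k • a k (t + x)
        - ∑ j ∈ Finset.range n, (j.choose k * x ^ j) • a j t)
      = (F (t + (i + 1) * x) - ∑ j ∈ Finset.range n, ((i + 1) * x) ^ j • a j t)
        - (F (t + x + i * x) - ∑ k ∈ Finset.range n, (i * x) ^ k • a k (t + x)) := by
    rw [sum_add_one_mul_pow_smul, show t + x + i * x = t + (i + 1) * x by ring]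
    simp only [smul_sub, Finset.sum_sub_distrib, smul_smul, mul_pow]
    abel
  rw [two_expansions]
  refine (norm_sub_le_of_le
    ((h t _ (by simpa using abs_add_lt 0 le_rfl (by linarith))
      (abs_add_lt _ (by linarith) hi_succ) n).trans (error_le _ (by linarith) hi_succ))
    ((h (t + x) _ (by simpa using abs_add_lt 1 zero_le_one (by linarith)) ?_ n).trans
      (error_le _ hi_nonneg (by linarith)))).trans_eq (by ring)
  convert abs_add_lt _ (by linarith) hi_succ using 2
  ring

lemma hasDerivAt_coeff (h : HasUniformTaylor F a M r) (k : ℕ) {t : ℝ} (ht : |t| < r) :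
    HasDerivAt (a k) (((k : ℝ) + 1) • a (k + 1) t) t := by
  obtain ⟨D, hD⟩ := h.exists_norm_pow_smul_sub_le (k + 2)
  have sum_eq : ∀ x : ℝ, ∑ j ∈ Finset.range (k + 2), (j.choose k * x ^ j) • a j t
      = x ^ k • (a k t + x • (((k : ℝ) + 1) • a (k + 1) t)) := fun x => by
    rw [Finset.sum_range_succ, Finset.sum_range_succ, Finset.sum_eq_zero fun j hj => by
      rw [Nat.choose_eq_zero_of_lt (Finset.mem_range.1 hj), Nat.cast_zero, zero_mul, zero_smul],
      Nat.choose_self, Nat.choose_succ_self_right]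
    push_cast
    module
  rw [hasDerivAt_iff_isLittleO_nhds_zero]
  refine (Asymptotics.IsBigO.of_bound D ?_).trans_isLittleO
    (Asymptotics.isLittleO_pow_id (𝕜 := ℝ) one_lt_two)
  have hx_lim : Tendsto (fun x : ℝ => ((k + 2 : ℕ) : ℝ) * |x|) (𝓝 0) (𝓝 0) :=
    Continuous.tendsto' (by fun_prop) _ _ (by simp)
  filter_upwards [hx_lim.eventually_lt_const (sub_pos.2 ht)] with x hx
  rcases eq_or_ne x 0 with rfl | hx0
  · simp
  · have bound := hD t x hx k (by omega)
    rw [sum_eq, ← smul_sub, norm_smul, norm_pow, Real.norm_eq_abs, pow_add, mul_left_comm] at bound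
    rw [sub_sub, norm_pow, Real.norm_eq_abs]
    exact le_of_mul_le_mul_left bound (by positivity)

lemma eventuallyEq_coeff_zero (h : HasUniformTaylor F a M r) (hr : 0 < r) : F =ᶠ[𝓝 0] a 0 := by
  filter_upwards [continuous_abs.tendsto' 0 0 abs_zero |>.eventually_lt_const hr] with t ht
  simpa [sub_eq_zero] using h t 0 ht (by simpa using ht) 1

lemma contDiffAt_and_iteratedDeriv (h : HasUniformTaylor F a M r) (hr : 0 < r) :
    ContDiffAt ℝ ∞ F 0 ∧ ∀ k, iteratedDeriv k F 0 = (k.factorial : ℝ) • a k 0 := by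
  let b : ℕ → ℝ → Y := fun k => (k.factorial : ℝ) • a k
  have hb : ∀ k, ∀ t ∈ {t : ℝ | |t| < r}, HasDerivAt (b k) (b (k + 1) t) t := fun k t ht => by
    convert (h.hasDerivAt_coeff k ht).const_smul (k.factorial : ℝ) using 1
    simp only [b, Pi.smul_apply, smul_smul, Nat.factorial_succ]
    push_cast
    rw [mul_comm]
  have hopen : IsOpen {t : ℝ | |t| < r} := isOpen_lt continuous_abs continuous_const
  have hmem : (0 : ℝ) ∈ {t : ℝ | |t| < r} := by simpa using hr
  have hF : F =ᶠ[𝓝 0] b 0 := by simpa [b] using h.eventuallyEq_coeff_zero hr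
  refine ⟨((contDiffOn_of_hasDerivAt_succ hopen hb).contDiffAt
    (hopen.mem_nhds hmem)).congr_of_eventuallyEq hF, fun k => ?_⟩
  rw [hF.iteratedDeriv_eq, iteratedDeriv_eqOn_of_hasDerivAt_succ hopen hb k hmem]
  rfl

end HasUniformTaylor

end ConverseTaylor

/-! ### Resolvents of self-adjoint operators -/

section SelfAdjoint

variable {E : Type*} [NormedAddCommGroup E] [InnerProductSpace ℂ E] {A : E →ₗ.[ℂ] E}

lemma norm_sq_sub_smul (hA : A.IsFormalAdjoint A) (lam : ℝ) (ψ : A.domain) :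
    ‖A ψ - (lam * Complex.I) • (ψ : E)‖ ^ 2 = ‖A ψ‖ ^ 2 + lam ^ 2 * ‖(ψ : E)‖ ^ 2 := by
  have inner_self_im : (inner ℂ (A ψ) (ψ : E)).im = 0 :=
    Complex.conj_eq_iff_im.1 ((inner_conj_symm _ _).trans (hA ψ ψ).symm)
  rw [@norm_sub_sq ℂ, inner_smul_right, norm_smul, mul_pow]
  simp [inner_self_im]

lemma norm_le_norm_sub_smul (hA : A.IsFormalAdjoint A) (lam : ℝ) (ψ : A.domain) :
    ‖A ψ‖ ≤ ‖A ψ - (lam * Complex.I) • (ψ : E)‖ := by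
  refine le_of_sq_le_sq ?_ (norm_nonneg _)
  rw [norm_sq_sub_smul hA]
  exact le_add_of_nonneg_right (by positivity)

lemma abs_mul_norm_le_norm_sub_smul (hA : A.IsFormalAdjoint A) (lam : ℝ) (ψ : A.domain) :
    |lam| * ‖(ψ : E)‖ ≤ ‖A ψ - (lam * Complex.I) • (ψ : E)‖ := by
  refine le_of_sq_le_sq ?_ (norm_nonneg _)
  rw [norm_sq_sub_smul hA, mul_pow, sq_abs]
  exact le_add_of_nonneg_left (by positivity)

/-- The operator `A - z` in terms of the points `(ψ, A ψ)` of the graph of `A`, which is a Hilbert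
space when `A` is closed. -/
def graphSubSMul (A : E →ₗ.[ℂ] E) (z : ℂ) : A.graph →L[ℂ] E :=
  (ContinuousLinearMap.snd ℂ E E - z • ContinuousLinearMap.fst ℂ E E) ∘L A.graph.subtypeL

lemma graphSubSMul_mk (z : ℂ) (ψ : A.domain) :
    graphSubSMul A z ⟨_, A.mem_graph ψ⟩ = A ψ - z • (ψ : E) := rfl

lemma exists_eq_mk_graph (p : A.graph) : ∃ ψ : A.domain, p = ⟨_, A.mem_graph ψ⟩ := by
  obtain ⟨⟨x, y⟩, hp⟩ := p
  obtain ⟨ψ, rfl, rfl⟩ := (LinearPMap.mem_graph_iff A).1 hp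
  exact ⟨ψ, rfl⟩

lemma antilipschitzWith_graphSubSMul (hA : A.IsFormalAdjoint A) {lam : ℝ} (hlam : lam ≠ 0) :
    AntilipschitzWith (1 + ‖lam‖₊⁻¹) (graphSubSMul A (lam * Complex.I)) := by
  refine AddMonoidHomClass.antilipschitz_of_bound _ fun p => ?_
  obtain ⟨ψ, rfl⟩ := exists_eq_mk_graph p
  rw [graphSubSMul_mk]
  set y := A ψ - (lam * Complex.I) • (ψ : E)
  have norm_le : ‖(ψ : E)‖ ≤ |lam|⁻¹ * ‖y‖ := by
    rw [le_inv_mul_iff₀ (abs_pos.2 hlam)]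
    exact abs_mul_norm_le_norm_sub_smul hA lam ψ
  have norm_apply_le : ‖A ψ‖ ≤ ‖y‖ := norm_le_norm_sub_smul hA lam ψ
  change max ‖(ψ : E)‖ ‖A ψ‖ ≤ (1 + |lam|⁻¹) * ‖y‖
  rw [add_mul, one_mul]
  exact max_le (norm_le.trans (le_add_of_nonneg_left (norm_nonneg _)))
    (norm_apply_le.trans (le_add_of_nonneg_right (by positivity)))

variable [CompleteSpace E]

lemma isFormalAdjoint_self (hA : IsSelfAdjoint A) : A.IsFormalAdjoint A := by
  have h := LinearPMap.adjoint_isFormalAdjoint hA.dense_domain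
  rwa [LinearPMap.isSelfAdjoint_def.1 hA] at h

lemma exists_apply_eq_of_forall_inner_eq (hA : IsSelfAdjoint A) {y w : E}
    (h : ∀ ψ : A.domain, inner ℂ w (ψ : E) = inner ℂ y (A ψ)) :
    ∃ hy : y ∈ A.domain, A ⟨y, hy⟩ = w := by
  have hmem := LinearPMap.mem_adjoint_domain_of_exists (T := A) y ⟨w, h⟩
  have happly := LinearPMap.adjoint_apply_eq hA.dense_domain ⟨y, hmem⟩ h
  rw [LinearPMap.isSelfAdjoint_def] at hA
  refine ⟨hA ▸ hmem, ?_⟩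
  rw [← happly]
  exact (le_of_eq hA.symm : A ≤ A.adjoint).2 rfl

lemma range_graphSubSMul (hA : IsSelfAdjoint A) {lam : ℝ} (hlam : lam ≠ 0) :
    (graphSubSMul A (lam * Complex.I)).range = ⊤ := by
  have hA_symm := isFormalAdjoint_self hA
  have : CompleteSpace A.graph := (show IsClosed (A.graph : Set (E × E)) from
    hA.isClosed).completeSpace_coe
  have hclosed : IsClosed ((graphSubSMul A (lam * Complex.I)).range : Set E) :=
    (antilipschitzWith_graphSubSMul hA_symm hlam).isClosed_range
      (graphSubSMul A (lam * Complex.I)).uniformContinuous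
  have := hclosed.completeSpace_coe
  rw [← Submodule.orthogonal_eq_bot_iff, Submodule.eq_bot_iff]
  intro y hy
  obtain ⟨hy_mem, hy_apply⟩ := exists_apply_eq_of_forall_inner_eq hA (y := y)
    (w := ((-lam : ℝ) * Complex.I) • y) fun ψ => by
      have h := Submodule.inner_left_of_mem_orthogonal
        (LinearMap.mem_range_self _ ⟨_, A.mem_graph ψ⟩) hy
      rw [ContinuousLinearMap.coe_coe, graphSubSMul_mk, inner_sub_right, inner_smul_right,
        sub_eq_zero] at h
      rw [h, inner_smul_left]
      simp
  have h := abs_mul_norm_le_norm_sub_smul hA_symm (-lam) ⟨y, hy_mem⟩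
  rw [hy_apply, sub_self, norm_zero] at h
  exact norm_le_zero_iff.1 (nonpos_of_mul_nonpos_right h (abs_pos.2 (neg_ne_zero.2 hlam)))

lemma exists_isResolvent (hA : IsSelfAdjoint A) {lam : ℝ} (hlam : lam ≠ 0) :
    ∃ R, IsResolvent A (lam * Complex.I) R := by
  have : CompleteSpace A.graph := (show IsClosed (A.graph : Set (E × E)) from
    hA.isClosed).completeSpace_coe
  have hinj := (antilipschitzWith_graphSubSMul (isFormalAdjoint_self hA) hlam).injective
  let e := ContinuousLinearEquiv.ofBijective (graphSubSMul A (lam * Complex.I))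
    (LinearMap.ker_eq_bot.2 hinj) (range_graphSubSMul hA hlam)
  refine ⟨ContinuousLinearMap.fst ℂ E E ∘L A.graph.subtypeL ∘L (e.symm : E →L[ℂ] A.graph),
    fun x => ?_, fun ψ => ?_⟩
  · obtain ⟨ψ, hψ⟩ := exists_eq_mk_graph (e.symm x)
    have hfst : (ContinuousLinearMap.fst ℂ E E ∘L A.graph.subtypeL ∘L (e.symm : E →L[ℂ] A.graph)) x
        = ψ := congrArg (fun p : A.graph => (p : E × E).1) hψ
    have happly : A ψ - (lam * Complex.I) • (ψ : E) = x := by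
      rw [← graphSubSMul_mk, ← hψ]
      exact e.apply_symm_apply x
    rw [hfst]
    exact ⟨ψ.2, happly⟩
  · exact congrArg (fun p : A.graph => (p : E × E).1) (e.symm_apply_apply ⟨_, A.mem_graph ψ⟩)

lemma isResolvent_resolventOp (hA : IsSelfAdjoint A) :
    IsResolvent A Complex.I (resolventOp A Complex.I) := by
  have h : ∃ R, IsResolvent A Complex.I R := by
    simpa using exists_isResolvent hA (one_ne_zero (α := ℝ))
  rw [resolventOp, dif_pos h]
  exact h.choose_spec

lemma isSelfAdjoint_of_surjective (hA : A.IsFormalAdjoint A) (hA_dense : Dense (A.domain : Set E))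
    {z : ℂ} (hz : ∀ y, ∃ ψ : A.domain, A ψ - z • (ψ : E) = y)
    (hz_conj : ∀ y, ∃ ψ : A.domain, A ψ - starRingEnd ℂ z • (ψ : E) = y) : IsSelfAdjoint A := by
  have hle : A ≤ A.adjoint := LinearPMap.IsFormalAdjoint.le_adjoint hA_dense hA
  rw [LinearPMap.isSelfAdjoint_def]
  refine (LinearPMap.eq_of_le_of_domain_eq hle (le_antisymm hle.1 fun y hy => ?_)).symm
  obtain ⟨ψ, hψ⟩ := hz (A.adjoint ⟨y, hy⟩ - z • y)
  have inner_eq_zero : ∀ φ : A.domain,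
      inner ℂ (y - (ψ : E)) (A φ - starRingEnd ℂ z • (φ : E)) = 0 := fun φ => by
    have hψ_apply : A.adjoint ⟨y, hy⟩ = A ψ - z • (ψ : E) + z • y := by rw [hψ, sub_add_cancel]
    have hy_inner : inner ℂ (A.adjoint ⟨y, hy⟩) (φ : E) = inner ℂ y (A φ) :=
      LinearPMap.adjoint_isFormalAdjoint hA_dense ⟨y, hy⟩ φ
    rw [hψ_apply, inner_add_left, inner_sub_left, inner_smul_left, inner_smul_left] at hy_inner
    rw [inner_sub_right, inner_sub_left, inner_sub_left, inner_smul_right, inner_smul_right,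
      ← hy_inner, ← hA ψ φ]
    ring
  obtain ⟨φ, hφ⟩ := hz_conj (y - ψ)
  have hy_eq : y = ψ := sub_eq_zero.1 (inner_self_eq_zero (𝕜 := ℂ).1 (by
    nth_rw 2 [← hφ]
    exact inner_eq_zero φ))
  exact hy_eq ▸ ψ.2

/-- `1 + 2i (A - i)⁻¹` is the Cayley transform `(A + i) (A - i)⁻¹`. -/
lemma isCayley_resolventOp (hA : IsSelfAdjoint A) : IsCayley (resolventOp A Complex.I) := by
  have hA_symm := isFormalAdjoint_self hA
  have hR := isResolvent_resolventOp hA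
  let U : E →L[ℂ] E := 1 + (2 * Complex.I) • resolventOp A Complex.I
  have cayley_apply : ∀ ψ : A.domain, U (A ψ - Complex.I • (ψ : E)) = A ψ + Complex.I • (ψ : E) :=
    fun ψ => by
      rw [add_apply, smul_apply, hR.2 ψ, one_apply_eq_self]
      module
  have norm_sub_eq_norm_add : ∀ ψ : A.domain,
      ‖A ψ - Complex.I • (ψ : E)‖ = ‖A ψ + Complex.I • (ψ : E)‖ := fun ψ => by
    have h := (norm_sq_sub_smul hA_symm 1 ψ).trans
      ((norm_sq_sub_smul hA_symm (-1) ψ).trans (by rw [neg_one_sq, one_pow])).symm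
    simpa [sub_neg_eq_add] using h
  have norm_map : ∀ x, ‖U x‖ = ‖x‖ := fun x => by
    obtain ⟨hx, hx_apply⟩ := hR.1 x
    rw [← hx_apply, cayley_apply ⟨_, hx⟩, norm_sub_eq_norm_add ⟨_, hx⟩]
  have surjective : Function.Surjective U := fun y => by
    obtain ⟨R, hR⟩ := exists_isResolvent hA (lam := -1) (by norm_num)
    obtain ⟨hy, hy_apply⟩ := hR.1 y
    exact ⟨_, (cayley_apply ⟨_, hy⟩).trans (by simpa using hy_apply)⟩
  have star_mul_self : star U * U = 1 :=
    (ContinuousLinearMap.norm_map_iff_adjoint_comp_self U).1 norm_map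
  refine Unitary.mem_iff.2 ⟨star_mul_self, ContinuousLinearMap.ext fun y => ?_⟩
  obtain ⟨x, rfl⟩ := surjective y
  exact congrArg U (congrArg (fun T : E →L[ℂ] E => T x) star_mul_self)

lemma denseRange_resolventOp (hA : IsSelfAdjoint A) : DenseRange (resolventOp A Complex.I) :=
  hA.dense_domain.mono fun ψ hψ => ⟨_, (isResolvent_resolventOp hA).2 ⟨ψ, hψ⟩⟩

end SelfAdjoint

/-! ### Relatively bounded perturbations -/

section Perturbation

variable {E : Type*} [NormedAddCommGroup E] [InnerProductSpace ℂ E] {A V : E →ₗ.[ℂ] E}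

/-- `‖V (A - z)⁻¹‖ ≤ M`, expressed through the vectors of `dom A ⊆ dom V` so that no resolvent has
to be chosen. -/
def ResolventBoundedWith (A V : E →ₗ.[ℂ] E) (z : ℂ) (M : ℝ) : Prop :=
  ∀ ψ : A.domain, ∃ hψ : (ψ : E) ∈ V.domain, ‖V ⟨ψ, hψ⟩‖ ≤ M * ‖A ψ - z • (ψ : E)‖

lemma ResolventBoundedWith.exists_comp_resolvent {z : ℂ} {M : ℝ}
    (h : ResolventBoundedWith A V z M) (hM : 0 ≤ M) {R : E →L[ℂ] E} (hR : IsResolvent A z R) :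
    ∃ K : E →L[ℂ] E, ‖K‖ ≤ M ∧ ∀ x, ∃ hx : R x ∈ V.domain, K x = V ⟨R x, hx⟩ := by
  have hR_mem : ∀ x, R x ∈ V.domain := fun x => by
    obtain ⟨hx, -⟩ := hR.1 x
    exact (h ⟨R x, hx⟩).1
  let K : E →ₗ[ℂ] E := V.toFun.comp ((R : E →ₗ[ℂ] E).codRestrict V.domain hR_mem)
  refine ⟨K.mkContinuous M fun x => ?_, K.mkContinuous_norm_le hM _, fun x => ⟨hR_mem x, rfl⟩⟩
  obtain ⟨hx, hx_apply⟩ := hR.1 x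
  obtain ⟨_, hVx⟩ := h ⟨R x, hx⟩
  rwa [hx_apply] at hVx

lemma RelBoundedWith.resolventBoundedWith {a b : ℝ} (h : RelBoundedWith A V a b)
    (hA : A.IsFormalAdjoint A) {lam : ℝ} (hlam : lam ≠ 0) :
    ResolventBoundedWith A V (lam * Complex.I) (a + b / |lam|) := fun ψ => by
  obtain ⟨ha, hb, hV⟩ := h
  obtain ⟨hψ, hVψ⟩ := hV ψ
  refine ⟨hψ, hVψ.trans ?_⟩
  rw [add_mul, div_mul_eq_mul_div, mul_div_assoc]
  gcongr
  · exact norm_le_norm_sub_smul hA lam ψ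
  · rw [le_div_iff₀ (abs_pos.2 hlam), mul_comm]
    exact abs_mul_norm_le_norm_sub_smul hA lam ψ

lemma mem_pert_domain {t : ℝ} {ψ : E} :
    ψ ∈ (pert A V t).domain ↔ ψ ∈ A.domain ∧ ψ ∈ V.domain := Iff.rfl

lemma pert_apply (t : ℝ) (ψ : (pert A V t).domain) :
    pert A V t ψ = A ⟨ψ, ψ.2.1⟩ + (t : ℂ) • V ⟨ψ, ψ.2.2⟩ := rfl

lemma pert_pert (t s : ℝ) : pert (pert A V t) V s = pert A V (t + s) := by
  refine LinearPMap.ext (Submodule.ext fun ψ => ?_) fun ψ hψ hψ_add => ?_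
  · simp only [mem_pert_domain]
    tauto
  · rw [pert_apply, pert_apply, pert_apply, Complex.ofReal_add, add_smul, add_assoc]

lemma pert_one : pert A V 1 = A + V := by
  rw [pert, Complex.ofReal_one, one_smul]

lemma isFormalAdjoint_pert (hA : A.IsFormalAdjoint A) (hV : V.IsFormalAdjoint V) (t : ℝ) :
    (pert A V t).IsFormalAdjoint (pert A V t) := fun x y => by
  rw [pert_apply, pert_apply, inner_add_left, inner_add_right, inner_smul_left, inner_smul_right,
    Complex.conj_ofReal]
  exact congrArg₂ (fun α β : ℂ => α + t * β) (hA ⟨x, x.2.1⟩ ⟨y, y.2.1⟩) (hV ⟨x, x.2.2⟩ ⟨y, y.2.2⟩)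

lemma ResolventBoundedWith.div_pert {z : ℂ} {M t : ℝ} (h : ResolventBoundedWith A V z M)
    (hM : 0 ≤ M) (ht : M * |t| < 1) :
    ResolventBoundedWith (pert A V t) V z (M / (1 - M * |t|)) := fun ψ => by
  refine ⟨ψ.2.2, ?_⟩
  set v := ‖V ⟨ψ, ψ.2.2⟩‖ with hv
  have norm_le : ‖A ⟨ψ, ψ.2.1⟩ - z • (ψ : E)‖ ≤ ‖pert A V t ψ - z • (ψ : E)‖ + |t| * v := by
    have split : A ⟨ψ, ψ.2.1⟩ - z • (ψ : E)
        = (pert A V t ψ - z • (ψ : E)) - (t : ℂ) • V ⟨ψ, ψ.2.2⟩ := by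
      rw [pert_apply]
      abel
    rw [split, hv, ← Real.norm_eq_abs, ← Complex.norm_real, ← norm_smul]
    exact norm_sub_le _ _
  have v_le : v ≤ M * (‖pert A V t ψ - z • (ψ : E)‖ + |t| * v) :=
    (h ⟨ψ, ψ.2.1⟩).2.trans (mul_le_mul_of_nonneg_left norm_le hM)
  rw [div_mul_eq_mul_div, le_div_iff₀ (sub_pos.2 ht)]
  linarith

lemma relBound_nonneg (A V : E →ₗ.[ℂ] E) : 0 ≤ relBound A V :=
  Real.sInf_nonneg fun _ h => h.choose_spec.1

variable [CompleteSpace E]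

/-- With `K = V (A - z)⁻¹` one has `A + tV - z = (1 + tK) (A - z)`, and `1 + tK` is inverted by a
Neumann series. -/
lemma ResolventBoundedWith.exists_pert_sub_smul_eq {z : ℂ} {M t : ℝ}
    (h : ResolventBoundedWith A V z M) (hM : 0 ≤ M) {R : E →L[ℂ] E} (hR : IsResolvent A z R)
    (ht : |t| * M < 1) (y : E) :
    ∃ ψ : (pert A V t).domain, pert A V t ψ - z • (ψ : E) = y := by
  obtain ⟨K, hK, hKV⟩ := h.exists_comp_resolvent hM hR
  have norm_lt : ‖-((t : ℂ) • K)‖ < 1 := by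
    rw [norm_neg, norm_smul, Complex.norm_real, Real.norm_eq_abs]
    exact (mul_le_mul_of_nonneg_left hK (abs_nonneg _)).trans_lt ht
  obtain ⟨x, hx⟩ : ∃ x, x + (t : ℂ) • K x = y := by
    obtain ⟨T, hT⟩ := (isUnit_one_sub_of_norm_lt_one norm_lt).exists_right_inv
    rw [sub_neg_eq_add] at hT
    exact ⟨T y, congrArg (fun B : E →L[ℂ] E => B y) hT⟩
  obtain ⟨hRx, hRx_apply⟩ := hR.1 x
  obtain ⟨hVx, hVx_apply⟩ := hKV x
  refine ⟨⟨R x, hRx, hVx⟩, ?_⟩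
  rw [pert_apply, add_sub_right_comm, hRx_apply, ← hVx_apply, hx]

/-- Kato–Rellich: as `‖V (A - i lam)⁻¹‖ ≤ a + b / lam`, the operator `t V (A - i lam)⁻¹` is a
contraction for large `lam`. -/
theorem isSelfAdjoint_pert_of_relBoundedWith (hA : IsSelfAdjoint A) (hV : V.IsFormalAdjoint V)
    {a b : ℝ} (h : RelBoundedWith A V a b) {t : ℝ} (ht : |t| * a < 1) :
    IsSelfAdjoint (pert A V t) := by
  have hA_symm := isFormalAdjoint_self hA
  obtain ⟨lam, hlam, hlam_lt⟩ : ∃ lam : ℝ, 0 < lam ∧ |t| * (a + b / lam) < 1 := by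
    have h_lim : Tendsto (fun lam : ℝ => |t| * (a + b / lam)) atTop (𝓝 (|t| * (a + 0))) :=
      (tendsto_const_nhds.add (tendsto_const_nhds.div_atTop tendsto_id)).const_mul _
    rw [add_zero] at h_lim
    exact ((eventually_gt_atTop 0).and (h_lim.eventually_lt_const ht)).exists
  have surjective : ∀ x : ℝ, |x| = lam →
      ∀ y, ∃ ψ : (pert A V t).domain, pert A V t ψ - (x * Complex.I) • (ψ : E) = y := by
    rintro x rfl
    obtain ⟨R, hR⟩ := exists_isResolvent hA (abs_pos.1 hlam)
    exact (h.resolventBoundedWith hA_symm (abs_pos.1 hlam)).exists_pert_sub_smul_eq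
      (add_nonneg h.1 (div_nonneg h.2.1 hlam.le)) hR hlam_lt
  refine isSelfAdjoint_of_surjective (isFormalAdjoint_pert hA_symm hV t)
    (hA.dense_domain.mono fun ψ hψ => ⟨hψ, (h.2.2 ⟨ψ, hψ⟩).1⟩)
    (surjective lam (abs_of_pos hlam)) ?_
  simpa using surjective (-lam) (by rw [abs_neg, abs_of_pos hlam])

theorem isSelfAdjoint_pert (hA : IsSelfAdjoint A) (hV : V.IsFormalAdjoint V)
    (hAV : RelBounded A V) {t : ℝ} (ht : |t| * relBound A V < 1) : IsSelfAdjoint (pert A V t) := by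
  obtain ⟨a, ⟨b, hab⟩, hta⟩ : ∃ a ∈ {a | ∃ b, RelBoundedWith A V a b}, |t| * a < 1 := by
    rcases (abs_nonneg t).eq_or_lt with h0 | hpos
    · obtain ⟨a, b, hab⟩ := hAV
      exact ⟨a, ⟨b, hab⟩, by simp [← h0]⟩
    · rw [← lt_inv_mul_iff₀ hpos] at ht
      obtain ⟨a, ha, ha_lt⟩ := exists_lt_of_csInf_lt hAV ht
      exact ⟨a, ha, (lt_inv_mul_iff₀ hpos).1 ha_lt⟩
  exact isSelfAdjoint_pert_of_relBoundedWith hA hV hab hta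

lemma resolventOp_sub_resolventOp_pert (hA : IsSelfAdjoint A) {K : E →L[ℂ] E}
    (hK : ∀ x, ∃ hx : resolventOp A Complex.I x ∈ V.domain,
      K x = V ⟨resolventOp A Complex.I x, hx⟩) {t : ℝ} (ht : IsSelfAdjoint (pert A V t)) :
    resolventOp A Complex.I - resolventOp (pert A V t) Complex.I
      = (t : ℂ) • (resolventOp (pert A V t) Complex.I * K) := by
  ext x
  obtain ⟨hx, hx_apply⟩ := (isResolvent_resolventOp hA).1 x
  obtain ⟨hVx, hKx⟩ := hK x
  have h := (isResolvent_resolventOp ht).2 ⟨resolventOp A Complex.I x, hx, hVx⟩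
  rw [pert_apply, add_sub_right_comm, hx_apply, ← hKx, map_add, map_smul] at h
  exact sub_eq_iff_eq_add'.2 h.symm

theorem ResolventBoundedWith.exists_taylor (hA : IsSelfAdjoint A) {M : ℝ}
    (h : ResolventBoundedWith A V Complex.I M) (hM : 0 ≤ M) {f : ℝ → ℂ} (hf : ContDiff ℝ ∞ f)
    (hf0 : Tendsto f (cocompact ℝ) (𝓝 0)) {μ : ℕ → ComplexMeasure ℝ}
    (hμ : ∀ p, IsFourierOf (weightedDeriv f p) (μ p)) :
    ∃ a : ℕ → E →L[ℂ] E, (∀ n, ‖a n‖ ≤ M ^ n * taylorConst μ n 0) ∧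
      ∀ s : ℝ, IsSelfAdjoint (pert A V s) → ∀ n,
        ‖funcCalc f (pert A V s) - ∑ k ∈ Finset.range n, s ^ k • a k‖
          ≤ M ^ n * taylorConst μ n 0 * |s| ^ n := by
  obtain ⟨K, hK, hKV⟩ := h.exists_comp_resolvent hM (isResolvent_resolventOp hA)
  obtain ⟨a, ha, ha_taylor⟩ := (isCayley_resolventOp hA).exists_taylor (K := K) hf hf0 hμ
  have mono : ∀ n, ‖K‖ ^ n * taylorConst μ n 0 ≤ M ^ n * taylorConst μ n 0 := fun n =>
    mul_le_mul_of_nonneg_right (pow_le_pow_left₀ (norm_nonneg _) hK n) (taylorConst_nonneg μ n 0)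
  refine ⟨a, fun n => (ha n).trans (mono n), fun s hs n => ?_⟩
  have h := ha_taylor s _ (isCayley_resolventOp hs) (denseRange_resolventOp hs)
    (resolventOp_sub_resolventOp_pert hA hKV hs) n
  simp only [← Complex.ofReal_pow, Complex.coe_smul] at h
  rw [Complex.norm_real, Real.norm_eq_abs, mul_assoc, mul_comm] at h
  exact h.trans (mul_le_mul_of_nonneg_right (mono n) (by positivity))

end Perturbation

/-! ### The Taylor series -/

section Perturbation

variable {E : Type*} [NormedAddCommGroup E] [InnerProductSpace ℂ E] [CompleteSpace E]
  {A V : E →ₗ.[ℂ] E} {f : ℝ → ℂ} {μ : ℕ → ComplexMeasure ℝ}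

lemma resolventBoundedWith_norm_relOp (hA : IsSelfAdjoint A) (hAV : RelBounded A V) :
    ResolventBoundedWith A V Complex.I ‖relOp A V‖ := fun ψ => by
  obtain ⟨a, b, hab⟩ := hAV
  have hR := isResolvent_resolventOp hA
  have hbound : ResolventBoundedWith A V Complex.I (a + b) := by
    simpa using hab.resolventBoundedWith (isFormalAdjoint_self hA) (one_ne_zero (α := ℝ))
  have relOp_apply : ∀ x : E, ∃ hx : resolventOp A Complex.I x ∈ V.domain,
      relOp A V x = V ⟨resolventOp A Complex.I x, hx⟩ := by
    have hex : ∃ K : E →L[ℂ] E, ∀ x : E, ∃ hx : resolventOp A Complex.I x ∈ V.domain,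
        K x = V ⟨resolventOp A Complex.I x, hx⟩ :=
      (hbound.exists_comp_resolvent (add_nonneg hab.1 hab.2.1) hR).imp fun _ hK => hK.2
    rw [relOp, dif_pos hex]
    exact hex.choose_spec
  obtain ⟨hψ, h⟩ := relOp_apply (A ψ - Complex.I • (ψ : E))
  simp only [hR.2 ψ] at hψ h
  exact ⟨hψ, h ▸ (relOp A V).le_opNorm _⟩

theorem exists_hasUniformTaylor_funcCalc_pert {ρ : ℝ} (hρ : 0 < ρ)
    (h_sa : ∀ t : ℝ, |t| < ρ → IsSelfAdjoint (pert A V t)) {M : ℝ} (hM : 0 ≤ M)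
    (h : ResolventBoundedWith A V Complex.I M) (hf : ContDiff ℝ ∞ f)
    (hf0 : Tendsto f (cocompact ℝ) (𝓝 0)) (hμ : ∀ p, IsFourierOf (weightedDeriv f p) (μ p)) :
    ∃ a : ℕ → ℝ → E →L[ℂ] E, ∃ r : ℝ, 0 < r ∧
      HasUniformTaylor (fun t : ℝ => funcCalc f (pert A V t)) a
        (fun n => (2 * M) ^ n * taylorConst μ n 0) r ∧
      (∀ n, ‖a n 0‖ ≤ M ^ n * taylorConst μ n 0) ∧
      ∀ s : ℝ, IsSelfAdjoint (pert A V s) → ∀ n,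
        ‖funcCalc f (pert A V s) - ∑ k ∈ Finset.range n, s ^ k • a k 0‖
          ≤ M ^ n * taylorConst μ n 0 * |s| ^ n := by
  set r := min ρ (1 / (2 * (M + 1)))
  have mul_abs_le_half : ∀ t : ℝ, |t| < r → M * |t| ≤ 1 / 2 := fun t ht => by
    have ht_lt := ht.trans_le (min_le_right _ _)
    rw [lt_div_iff₀ (by positivity)] at ht_lt
    nlinarith [abs_nonneg t]
  have exists_taylor : ∀ t : ℝ, ∃ a : ℕ → E →L[ℂ] E, |t| < r →
      (∀ n, ‖a n‖ ≤ (M / (1 - M * |t|)) ^ n * taylorConst μ n 0) ∧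
      ∀ s : ℝ, IsSelfAdjoint (pert A V (t + s)) → ∀ n,
        ‖funcCalc f (pert A V (t + s)) - ∑ k ∈ Finset.range n, s ^ k • a k‖
          ≤ (M / (1 - M * |t|)) ^ n * taylorConst μ n 0 * |s| ^ n := fun t => by
    by_cases ht : |t| < r
    · have hMt : M * |t| < 1 := (mul_abs_le_half t ht).trans_lt one_half_lt_one
      obtain ⟨a, ha⟩ := (h.div_pert hM hMt).exists_taylor (h_sa t (ht.trans_le (min_le_left _ _)))
        (div_nonneg hM (sub_nonneg.2 hMt.le)) hf hf0 hμ
      simp only [pert_pert] at ha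
      exact ⟨a, fun _ => ha⟩
    · exact ⟨0, fun ht_lt => absurd ht_lt ht⟩
  choose a ha using exists_taylor
  have hr_pos : 0 < r := lt_min hρ (by positivity)
  obtain ⟨norm_le, taylor⟩ := ha 0 (by simpa using hr_pos)
  simp only [abs_zero, mul_zero, sub_zero, div_one, zero_add] at norm_le taylor
  refine ⟨fun n t => a t n, r, hr_pos, fun t s ht hts n => ?_, norm_le, taylor⟩
  have half_le : 1 / 2 ≤ 1 - M * |t| := by linarith [mul_abs_le_half t ht]
  refine ((ha t ht).2 s (h_sa _ (hts.trans_le (min_le_left _ _))) n).trans ?_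
  have div_nonneg : 0 ≤ M / (1 - M * |t|) := div_nonneg hM (one_half_pos.le.trans half_le)
  have div_le : M / (1 - M * |t|) ≤ 2 * M := by
    rw [div_le_iff₀ (one_half_pos.trans_le half_le)]
    nlinarith
  exact mul_le_mul_of_nonneg_right (mul_le_mul_of_nonneg_right
    (pow_le_pow_left₀ div_nonneg div_le n) (taylorConst_nonneg μ n 0)) (by positivity)

theorem contDiffAt_funcCalc_pert_and_taylorTerm_le (hA : IsSelfAdjoint A) (hV : V.IsFormalAdjoint V)
    (hAV : RelBounded A V) (ha : relBound A V < 1) (hf : ContDiff ℝ ∞ f)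
    (hf0 : Tendsto f (cocompact ℝ) (𝓝 0)) (hμ : ∀ p, IsFourierOf (weightedDeriv f p) (μ p)) :
    ContDiffAt ℝ ∞ (fun t : ℝ => funcCalc f (pert A V t)) 0 ∧
      (∀ n, ‖taylorTerm f A V n‖ ≤ ‖relOp A V‖ ^ n * taylorConst μ n 0) ∧
      ∀ n, ‖funcCalc f (A + V) - ∑ k ∈ Finset.range n, taylorTerm f A V k‖
        ≤ ‖relOp A V‖ ^ n * taylorConst μ n 0 := by
  have h_sa : ∀ t : ℝ, |t| ≤ 1 → IsSelfAdjoint (pert A V t) := fun t ht =>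
    isSelfAdjoint_pert hA hV hAV
      ((mul_le_of_le_one_left (relBound_nonneg A V) ht).trans_lt ha)
  obtain ⟨a, r, hr, h_taylor, norm_le, remainder_le⟩ := exists_hasUniformTaylor_funcCalc_pert
    one_pos (fun t ht => h_sa t ht.le) (norm_nonneg _) (resolventBoundedWith_norm_relOp hA hAV)
    hf hf0 hμ
  obtain ⟨h_smooth, h_deriv⟩ := h_taylor.contDiffAt_and_iteratedDeriv hr
  have taylorTerm_eq : ∀ n, taylorTerm f A V n = a n 0 := fun n => by
    rw [taylorTerm, h_deriv n, smul_smul, inv_mul_cancel₀ (by positivity), one_smul]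
  refine ⟨h_smooth, fun n => taylorTerm_eq n ▸ norm_le n, fun n => ?_⟩
  simpa [taylorTerm_eq, pert_one] using remainder_le 1 (h_sa 1 (by simp)) n

end Perturbation

section Convergence

variable {μ : ℕ → ComplexMeasure ℝ} {c C : ℝ}

lemma taylorConst_le (h : ∀ p, (μ p).variation.real Set.univ / p.factorial ≤ c * C ^ p) (n q : ℕ) :
    taylorConst μ n q ≤ c * C ^ q * (1 + C) ^ n := by
  induction n generalizing q with
  | zero => simpa [taylorConst] using h q
  | succ n ih =>
    rw [taylorConst]
    linear_combination ih (q + 1) + ih q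

lemma pow_mul_taylorConst_le {κ : ℝ} (hκ : 0 ≤ κ)
    (h : ∀ p, (μ p).variation.real Set.univ / p.factorial ≤ c * C ^ p) (n : ℕ) :
    κ ^ n * taylorConst μ n 0 ≤ c * ((1 + C) * κ) ^ n := by
  rw [mul_pow]
  linear_combination κ ^ n * taylorConst_le h n 0

lemma summable_norm_and_hasSum_of_geometric {Y : Type*} [NormedAddCommGroup Y] [CompleteSpace Y]
    {x : ℕ → Y} {y : Y} {q : ℝ} (hq0 : 0 ≤ q) (hq : q < 1) (hx : ∀ n, ‖x n‖ ≤ c * q ^ n)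
    (hy : ∀ n, ‖y - ∑ k ∈ Finset.range n, x k‖ ≤ c * q ^ n) :
    Summable (fun n => ‖x n‖) ∧ HasSum x y := by
  have hs : Summable fun n => ‖x n‖ := Summable.of_nonneg_of_le (fun n => norm_nonneg _) hx
    ((summable_geometric_of_lt_one hq0 hq).mul_left c)
  refine ⟨hs, hs.of_norm.hasSum_iff_tendsto_nat.2 ?_⟩
  rw [tendsto_iff_norm_sub_tendsto_zero]
  refine squeeze_zero (fun n => norm_nonneg _) (fun n => (norm_sub_rev _ _).trans_le (hy n)) ?_
  simpa using (tendsto_pow_atTop_nhds_zero_of_lt_one hq0 hq).const_mul c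

lemma summable_norm_and_hasSum_of_taylorConst {Y : Type*} [NormedAddCommGroup Y] [CompleteSpace Y]
    {x : ℕ → Y} {y : Y} {κ : ℝ} (hκ : 0 ≤ κ) (hC : 0 ≤ C)
    (h : ∀ p, 1 ≤ p → (μ p).variation.real Set.univ / p.factorial ≤ c * C ^ p)
    (hlt : (1 + C) * κ < 1) (hx : ∀ n, ‖x n‖ ≤ κ ^ n * taylorConst μ n 0)
    (hy : ∀ n, ‖y - ∑ k ∈ Finset.range n, x k‖ ≤ κ ^ n * taylorConst μ n 0) :
    Summable (fun n => ‖x n‖) ∧ HasSum x y := by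
  have h_all : ∀ p, (μ p).variation.real Set.univ / p.factorial
      ≤ max c ((μ 0).variation.real Set.univ) * C ^ p := fun p => by
    rcases Nat.eq_zero_or_pos p with rfl | hp
    · simp
    · exact (h p hp).trans (mul_le_mul_of_nonneg_right (le_max_left _ _) (by positivity))
  exact summable_norm_and_hasSum_of_geometric (by positivity) hlt
    (fun n => (hx n).trans (pow_mul_taylorConst_le hκ h_all n))
    (fun n => (hy n).trans (pow_mul_taylorConst_le hκ h_all n))

lemma exists_pow_mul_factorial_rpow_le {γ ε : ℝ} (hC : 0 ≤ C) (hγ : γ < 1) (hε : 0 < ε) :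
    ∃ G : ℝ, ∀ p : ℕ, C ^ p * (p.factorial : ℝ) ^ γ / p.factorial ≤ G * ε ^ p := by
  have hγ_sub : 0 < 1 - γ := sub_pos.2 hγ
  have hCε : 0 ≤ C / ε := by positivity
  set D : ℝ := (C / ε) ^ (1 - γ)⁻¹ with hD
  have hD0 : 0 ≤ D := Real.rpow_nonneg hCε _
  have D_rpow : D ^ (1 - γ) = C / ε := by
    rw [hD, ← Real.rpow_mul hCε, inv_mul_cancel₀ hγ_sub.ne', Real.rpow_one]
  refine ⟨Real.exp D ^ (1 - γ), fun p => ?_⟩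
  have hp : (0 : ℝ) < p.factorial := by positivity
  calc C ^ p * (p.factorial : ℝ) ^ γ / p.factorial
      = (C / ε) ^ p * ((p.factorial : ℝ) ^ γ / p.factorial) * ε ^ p := by
        rw [div_pow]
        field_simp
    _ = (D ^ p / p.factorial) ^ (1 - γ) * ε ^ p := by
        rw [Real.div_rpow (by positivity) hp.le, ← Real.rpow_pow_comm hD0, D_rpow,
          Real.rpow_sub hp, Real.rpow_one, div_div_eq_mul_div, mul_div_assoc]
    _ ≤ Real.exp D ^ (1 - γ) * ε ^ p := by
        gcongr
        exact Real.pow_div_factorial_le_exp D hD0 p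

lemma variation_real_div_factorial_le {ν : ComplexMeasure ℝ} {x : ℝ} (hx : 0 ≤ x) {p : ℕ}
    (h : ν.variation Set.univ ≤ ENNReal.ofReal (x * p.factorial)) :
    ν.variation.real Set.univ / p.factorial ≤ x :=
  div_le_of_le_mul₀ (Nat.cast_nonneg _) hx (ENNReal.toReal_le_of_le_ofReal (by positivity) h)

lemma exists_variation_real_div_factorial_le {γ ε : ℝ} (hc : 0 ≤ c) (hC : 0 ≤ C) (hγ : γ < 1)
    (hε : 0 < ε) (h : ∀ p : ℕ, 1 ≤ p →
      (μ p).variation Set.univ ≤ ENNReal.ofReal (c * C ^ p * (p.factorial : ℝ) ^ γ)) :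
    ∃ G : ℝ, ∀ p : ℕ, 1 ≤ p → (μ p).variation.real Set.univ / p.factorial ≤ G * ε ^ p := by
  obtain ⟨G, hG⟩ := exists_pow_mul_factorial_rpow_le hC hγ hε
  refine ⟨c * G, fun p hp => ?_⟩
  calc (μ p).variation.real Set.univ / p.factorial
      ≤ c * C ^ p * (p.factorial : ℝ) ^ γ / p.factorial := by
        gcongr
        exact ENNReal.toReal_le_of_le_ofReal (by positivity) (h p hp)
    _ = c * (C ^ p * (p.factorial : ℝ) ^ γ / p.factorial) := by ring
    _ ≤ c * (G * ε ^ p) := mul_le_mul_of_nonneg_left (hG p) hc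
    _ = c * G * ε ^ p := (mul_assoc _ _ _).symm

end Convergence

end RelTaylor

end

theorem mainTheorem2_general {E : Type*} [NormedAddCommGroup E] [InnerProductSpace ℂ E]
    [CompleteSpace E]
    (H V : E →ₗ.[ℂ] E) (hH : IsSelfAdjoint H) (hV : V.IsFormalAdjoint V)
    (hHV : RelTaylor.RelBounded H V) (ha : RelTaylor.relBound H V < 1)
    (f : ℝ → ℂ) (hf : ContDiff ℝ ∞ f) (hf0 : Tendsto f (cocompact ℝ) (𝓝 0))
    (μ : ℕ → ComplexMeasure ℝ)
    (hμ : ∀ n, RelTaylor.IsFourierOf (RelTaylor.weightedDeriv f n) (μ n))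
    (c C : ℝ) (hc : 0 ≤ c) (hC : 0 ≤ C) :
    (∀ t : ℝ, |t| * RelTaylor.relBound H V < 1 → IsSelfAdjoint (RelTaylor.pert H V t)) ∧
    ContDiffAt ℝ ∞ (fun t : ℝ => RelTaylor.funcCalc f (RelTaylor.pert H V t)) 0 ∧
    ((∀ n : ℕ, 1 ≤ n →
        (μ n).variation Set.univ ≤ ENNReal.ofReal (c * C ^ n * n.factorial)) →
      (1 + C) * ‖RelTaylor.relOp H V‖ < 1 →
      Summable (fun n => ‖RelTaylor.taylorTerm f H V n‖) ∧
      HasSum (RelTaylor.taylorTerm f H V) (RelTaylor.funcCalc f (H + V))) ∧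
    ((∀ n : ℕ, (μ n).variation Set.univ ≤ ENNReal.ofReal (c * C ^ n * n.factorial)) →
      ∀ n : ℕ, ‖RelTaylor.funcCalc f (H + V)
          - ∑ k ∈ Finset.range n, RelTaylor.taylorTerm f H V k‖
        ≤ c * ((1 + C) * ‖RelTaylor.relOp H V‖) ^ n) ∧
    (∀ γ : ℝ, γ < 1 →
      (∀ n : ℕ, 1 ≤ n →
        (μ n).variation Set.univ ≤ ENNReal.ofReal (c * C ^ n * (n.factorial : ℝ) ^ γ)) →
      ‖RelTaylor.relOp H V‖ < 1 →
      Summable (fun n => ‖RelTaylor.taylorTerm f H V n‖) ∧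
      HasSum (RelTaylor.taylorTerm f H V) (RelTaylor.funcCalc f (H + V))) := by
  obtain ⟨smooth, term_le, remainder_le⟩ :=
    RelTaylor.contDiffAt_funcCalc_pert_and_taylorTerm_le hH hV hHV ha hf hf0 hμ
  have series := fun {c' C' : ℝ} (hC' : 0 ≤ C') h h_lt =>
    RelTaylor.summable_norm_and_hasSum_of_taylorConst (c := c') (norm_nonneg _) hC' h h_lt
      term_le remainder_le
  refine ⟨fun t => RelTaylor.isSelfAdjoint_pert hH hV hHV, smooth, fun h => ?_, fun h n => ?_,
    fun γ hγ h h_lt => ?_⟩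
  · exact series hC fun p hp => RelTaylor.variation_real_div_factorial_le (by positivity) (h p hp)
  · exact (remainder_le n).trans (RelTaylor.pow_mul_taylorConst_le (norm_nonneg _)
      (fun p => RelTaylor.variation_real_div_factorial_le (by positivity) (h p)) n)
  · obtain ⟨ε, hε, hε_lt⟩ : ∃ ε : ℝ, 0 < ε ∧ (1 + ε) * ‖RelTaylor.relOp H V‖ < 1 :=
      ⟨(1 - ‖RelTaylor.relOp H V‖) / 2, by linarith, by nlinarith⟩
    obtain ⟨G, hG⟩ := RelTaylor.exists_variation_real_div_factorial_le hc hC hγ hε h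
    exact series hε.le hG hε_lt

theorem mainTheorem2 {E : Type*} [NormedAddCommGroup E] [InnerProductSpace ℂ E] [CompleteSpace E]
    [TopologicalSpace.SeparableSpace E]
    (H V : E →ₗ.[ℂ] E) (hH : IsSelfAdjoint H) (hV : V.IsFormalAdjoint V)
    (hHV : RelTaylor.RelBounded H V) (ha : RelTaylor.relBound H V < 1)
    (f : ℝ → ℂ) (hf : ∀ n : ℕ, 1 ≤ n → f ∈ RelTaylor.W n)
    (μ : ℕ → ComplexMeasure ℝ)
    (hμ : ∀ n, RelTaylor.IsFourierOf (RelTaylor.weightedDeriv f n) (μ n))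
    (c C : ℝ) (hc : 0 ≤ c) (hC : 0 ≤ C) :
    -- the operators `H + tV` are self-adjoint, and all derivatives at `t = 0` exist in norm
    (∀ t : ℝ, |t| * RelTaylor.relBound H V < 1 → IsSelfAdjoint (RelTaylor.pert H V t)) ∧
    ContDiffAt ℝ ∞ (fun t : ℝ => RelTaylor.funcCalc f (RelTaylor.pert H V t)) 0 ∧
    -- absolutely norm-convergent Taylor expansion
    ((∀ n : ℕ, 1 ≤ n →
        (μ n).variation Set.univ ≤ ENNReal.ofReal (c * C ^ n * n.factorial)) →
      (1 + C) * ‖RelTaylor.relOp H V‖ < 1 →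
      Summable (fun n => ‖RelTaylor.taylorTerm f H V n‖) ∧
      HasSum (RelTaylor.taylorTerm f H V) (RelTaylor.funcCalc f (H + V))) ∧
    -- bound of the Taylor remainder
    ((∀ n : ℕ, (μ n).variation Set.univ ≤ ENNReal.ofReal (c * C ^ n * n.factorial)) →
      ∀ n : ℕ, ‖RelTaylor.funcCalc f (H + V)
          - ∑ k ∈ Finset.range n, RelTaylor.taylorTerm f H V k‖
        ≤ c * ((1 + C) * ‖RelTaylor.relOp H V‖) ^ n) ∧
    -- slower growth: no smallness in terms of `C`
    (∀ γ : ℝ, γ < 1 →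
      (∀ n : ℕ, 1 ≤ n →
        (μ n).variation Set.univ ≤ ENNReal.ofReal (c * C ^ n * (n.factorial : ℝ) ^ γ)) →
      ‖RelTaylor.relOp H V‖ < 1 →
      Summable (fun n => ‖RelTaylor.taylorTerm f H V n‖) ∧
      HasSum (RelTaylor.taylorTerm f H V) (RelTaylor.funcCalc f (H + V))) :=
  have hf0 : f ∈ RelTaylor.W₀ := by
    simpa [RelTaylor.weightedDeriv] using (hf 1 le_rfl).2 0 zero_le_one
  mainTheorem2_general H V hH hV hHV ha f
    (contDiff_infty.2 fun n => (hf (n + 1) n.succ_pos).1.of_le (by exact_mod_cast n.le_succ))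
    hf0.2.1 μ hμ c C hc hC
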